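/- **Model.** Consider curves $(i,j)$, $1\le j\le J_i$, $1\le i\le I$, and fix $\nu>1$, $\sigma>0$. At times $t_1,\dots,t_n$ (which may depend on $n$) curve $(i,j)$ has responses $$y_{ij}(t_l)=\mu(t_l)+\alpha_i(t_l)+\tau_{0,ij}(u_{ij}(t_l))+\varepsilon_{ij}(t_l),\qquad l=1,\dots,n,$$ with known mean functions $\mu,\alpha_i$, $\sum_i\alpha_i=0$, a fixed true random-effect function $\tau_{0,ij}:\mathcal X\to\mathbb R$, $\mathcal X\subset\mathbb R^p$, covariates $U_n=(u_{ij}(t_1),\dots,u_{ij}(t_n))$ drawn independently from a distribution on $\mathcal X$, and an error vector, independent of the covariates, with the extended multivariate $t$-density $$f(z)=\big(2\pi(\nu-1)\sigma^2\big)^{-n/2}\,\frac{\Gamma(n/2+\nu)}{\Gamma(\nu)}\Big(1+\frac{\|z\|^2}{2(\nu-1)\sigma^2}\Big)^{-(n/2+\nu)},\qquad z\in\mathbb R^n .$$ Different curves are independent. Write $D_n$ for the data (covariates and responses) of all curves. Given the covariates of curve $(i,j)$, let $p(\cdot\mid\tau)$ be the density of $Y_{ij}=(y_{ij}(t_1),\dots,y_{ij}(t_n))$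 when the random effect is $\tau$; let $p_0=p(\cdot\mid\tau_{0,ij})$, and for a parameter $\theta$ let $p_{TP,\theta}=\int p(\cdot\mid\tau)\,dp_\theta(\tau)$, where $p_\theta$ is the law of the Gaussian process $GP(0,k(\cdot,\cdot;\theta))$. The Bayesian predictive density $p_{TP}$ of $Y_{ij}$ is $p_{TP,\hat\theta_{ijn}}$, where $\hat\theta_{ijn}$ is an estimator computed from $D_n$. **Theorem 2.** Let $k(\cdot,\cdot;\theta)$, $\theta\in\Theta\subset\mathbb R^q$, be measurable positive semidefinite kernels on $\mathcal X$ that are bounded (by one constant on $\mathcal X\times\mathcal X\times\Theta$) and pointwise continuous in $\theta$. For every curve let $\hat\theta_{ijn}\in\Theta$ be a consistent estimator of $\theta_{ij}\in\Theta$ (it converges to $\theta_{ij}$ in probability as $n\to\infty$), and assume condition (A): $\tau_{0,ij}$ has finite norm in the reproducing kernel Hilbert space of $k(\cdot,\cdot;\theta_{ij})$, and $$E_{U_n}\log\big|I_n+\sigma^{-2}K_{ij}\big|=o(n),\qquad K_{ij}=\big(k(u_{ij}(t_l),u_{ij}(t_m);\theta_{ij})\big)_{l,m\le n}.$$ Then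 for every curve $(i,j)$, with $\mathrm{KL}(f\,\|\,g)=\int f\log(f/g)$, $$\frac1n\,E\big[\mathrm{KL}\big(p_0(Y_{ij})\,\big\|\,p_{TP}(Y_{ij})\big)\big]\to0\qquad(n\to\infty),$$ where the expectation is over the data $D_n$, that is, over the covariates $U_n$ and over the estimator $\hat\theta_{ijn}=\hat\theta_{ijn}(D_n)$. Also $$\frac1n\,E_{D_n}\Big[E_{U_n}\,\mathrm{KL}\big(p_0(Y_{ij})\,\big\|\,p_{TP,\theta}(Y_{ij})\big)\Big|_{\theta=\hat\theta_{ijn}(D_n)}\Big]\to0 ,$$ where $E_{U_n}$ is taken over the covariates of the curve with the value of the estimator held fixed. -/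

import Mathlib

open MeasureTheory ProbabilityTheory Filter Topology Asymptotics
open scoped ENNReal

namespace FAnova

noncomputable section

/-- A real kernel on `X`, written as a kernel with values in the operators on `ℝ`. -/
def opKernel {X : Type*} (k : X → X → ℝ) : Matrix X X (ℝ →L[ℝ] ℝ) :=
  Matrix.of fun x y => k x y • ContinuousLinearMap.id ℝ ℝ

/-- `f` lies in the reproducing kernel Hilbert space of the kernel `k`, and its norm there is at
most `M`. -/
def RKHSNormLE {X : Type*} (k : X → X → ℝ) (f : X → ℝ) (M : ℝ) : Prop :=
  ∃ hk : (opKernel k).PosSemidef,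
    haveI : Fact (opKernel k).PosSemidef := ⟨hk⟩
    ∃ h : RKHS.OfKernel (opKernel k), ⇑h = f ∧ ‖h‖ ≤ M

/-- The covariance matrix `(k (u_l, u_m))` of a random function with covariance `k` at the points
`u_1, …, u_n`. -/
def gram {X : Type*} (k : X → X → ℝ) {n : ℕ} (u : Fin n → X) : Matrix (Fin n) (Fin n) ℝ :=
  Matrix.of fun l m => k (u l) (u m)

/-- The density at `z ∈ ℝⁿ` of the extended multivariate t-distribution
`EMTD(ν, ν - 1, 0, σ² Iₙ)`. -/
def emtdDensity (ν σ : ℝ) {n : ℕ} (z : Fin n → ℝ) : ℝ :=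
  (2 * Real.pi * (ν - 1) * σ ^ 2) ^ (-((n : ℝ) / 2))
    * (Real.Gamma ((n : ℝ) / 2 + ν) / Real.Gamma ν)
    * (1 + (∑ l, z l ^ 2) / (2 * (ν - 1) * σ ^ 2)) ^ (-((n : ℝ) / 2 + ν))

/-- `p(y_1, …, y_n | τ)`: the density of the responses at covariates `u_1, …, u_n`, when their
mean values are `m_1, …, m_n` and the random effect is the function `τ`. -/
def condDensity (ν σ : ℝ) {X : Type*} {n : ℕ} (m : Fin n → ℝ) (τ : X → ℝ) (u : Fin n → X)
    (y : Fin n → ℝ) : ℝ :=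
  emtdDensity ν σ fun l => y l - m l - τ (u l)

/-- The Bayesian predictive density `p_TP`: the mixture of the densities `p(y_1, …, y_n | τ)` over
the Gaussian process `τ ∼ GP(0, k)`. As `p(y_1, …, y_n | τ)` involves `τ` only through
`(τ(u_1), …, τ(u_n))`, the integral is written with the law `N(0, (k (u_l, u_m)))` of this vector;
`predDensity_eq_integral_process` is the same formula on the space of all functions. -/
def predDensity (ν σ : ℝ) {X : Type*} (k : X → X → ℝ) {n : ℕ} (m : Fin n → ℝ) (u : Fin n → X)
    (y : Fin n → ℝ) : ℝ :=
  ∫ t : EuclideanSpace ℝ (Fin n), emtdDensity ν σ (fun l => y l - m l - t l)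
    ∂(multivariateGaussian 0 (gram k u))

/-- `predDensity` is the integral of `p(y_1, …, y_n | τ)` over the space of all functions `τ`, with
respect to the law `G` of a Gaussian process with mean zero and covariance `k`. -/
theorem predDensity_eq_integral_process (ν σ : ℝ) {X : Type*} (k : X → X → ℝ)
    (hk : (Matrix.of k).PosSemidef) (G : Measure (X → ℝ))
    (hG : IsGaussianProcess (fun (x : X) (τ : X → ℝ) => τ x) G)
    (hmean : ∀ x, ∫ τ, τ x ∂G = 0)
    (hcov : ∀ x x', cov[fun τ : X → ℝ => τ x, fun τ => τ x'; G] = k x x')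
    {n : ℕ} (m : Fin n → ℝ) (u : Fin n → X) (y : Fin n → ℝ) :
    ∫ τ, condDensity ν σ m τ u y ∂G = predDensity ν σ k m u y := by
  have := hG.isProbabilityMeasure
  have hS : (gram k u).PosSemidef := hk.submatrix u
  have hm : Measurable fun τ : X → ℝ => WithLp.toLp 2 fun l => τ (u l) := by fun_prop
  have hL : HasGaussianLaw (fun τ : X → ℝ => WithLp.toLp 2 fun l => τ (u l)) G := by
    classical
    let L : ((Finset.univ.image u) → ℝ) →L[ℝ] EuclideanSpace ℝ (Fin n) :=
      (PiLp.continuousLinearEquiv 2 ℝ (fun _ : Fin n => ℝ)).symm.toContinuousLinearMap ∘L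
        ContinuousLinearMap.pi fun l => ContinuousLinearMap.proj ⟨u l, by simp⟩
    exact (hG.hasGaussianLaw (Finset.univ.image u)).map L
  have hmap : G.map (fun τ : X → ℝ => WithLp.toLp 2 fun l => τ (u l))
      = multivariateGaussian 0 (gram k u) := by
    have := hL.isGaussian_map
    apply IsGaussian.ext
    · rw [integral_id_multivariateGaussian']
      ext l
      rw [integral_map hm.aemeasurable (by fun_prop)]
      have h1 : Integrable (fun τ : X → ℝ => WithLp.toLp 2 fun l => τ (u l)) G := hL.integrable
      have := ((EuclideanSpace.proj l : EuclideanSpace ℝ (Fin n) →L[ℝ] ℝ)).integral_comp_comm h1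
      simp only [id_eq]
      simp at this
      rw [← this, hmean]
      rfl
    · rw [← ContinuousLinearMap.toBilinForm_inj]
      refine LinearMap.BilinForm.ext_of_isSymm isPosSemidef_covarianceBilin.isSymm
        isPosSemidef_covarianceBilin.isSymm fun x => ?_
      simp only [ContinuousLinearMap.toBilinForm_apply]
      rw [covarianceBilin_apply_pi, covarianceBilin_multivariateGaussian hS]
      · simp only [hcov]
        simp [Matrix.mulVec, dotProduct, gram, Finset.mul_sum, mul_comm, mul_left_comm]
      · exact fun l => (hG.hasGaussianLaw_eval (u l)).memLp_two
  rw [predDensity, ← hmap, integral_map hm.aemeasurable]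
  · rfl
  · refine Measurable.aestronglyMeasurable ?_
    unfold emtdDensity
    fun_prop

/-- The Kullback-Leibler divergence `D[f, g]` of two densities on `ℝⁿ`. -/
def klDensity {n : ℕ} (f g : (Fin n → ℝ) → ℝ) : ℝ≥0∞ :=
  InformationTheory.klDiv (volume.withDensity fun y => ENNReal.ofReal (f y))
    (volume.withDensity fun y => ENNReal.ofReal (g y))

/-- The curves `(i, j)`, `1 ≤ j ≤ J_i`, `1 ≤ i ≤ I`. -/
abbrev Curve {I : ℕ} (J : Fin I → ℕ) : Type := Σ i : Fin I, Fin (J i)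

/-- The observations at `n` times: covariates and responses of every curve. -/
abbrev DataSet (X : Type*) {I : ℕ} (J : Fin I → ℕ) (n : ℕ) : Type _ :=
  Curve J → (Fin n → X) × (Fin n → ℝ)

/-- The mean values `μ(t_l) + α_i(t_l)` of the curve `(i, j)` at the times `t_1, …, t_n`. -/
def meanVec (μ : ℝ → ℝ) {I : ℕ} (α : Fin I → ℝ → ℝ) {J : Fin I → ℕ} (c : Curve J) {n : ℕ}
    (t : Fin n → ℝ) : Fin n → ℝ :=
  fun l => μ (t l) + α c.1 (t l)

/-- The law of the observations of one curve at `n` times: the covariates are independent with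
law `P`, and given them the responses have the density of the model with random effect `τ`. -/
def curveLaw (ν σ : ℝ) {X : Type*} [MeasurableSpace X] (P : Measure X) (τ : X → ℝ) {n : ℕ}
    (m : Fin n → ℝ) : Measure ((Fin n → X) × (Fin n → ℝ)) :=
  ((Measure.pi fun _ : Fin n => P).prod volume).withDensity
    fun d => ENNReal.ofReal (condDensity ν σ m τ d.1 d.2)

/-- The law of the data set at the times `t_1, …, t_n`: the curves are independent, and the curve
`c` has covariate law `P c` and random effect `τ c`. -/
def dataLaw (ν σ : ℝ) {X : Type*} [MeasurableSpace X] {I : ℕ} {J : Fin I → ℕ} (μ : ℝ → ℝ)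
    (α : Fin I → ℝ → ℝ) (P : Curve J → Measure X) (τ : Curve J → X → ℝ) {n : ℕ}
    (t : Fin n → ℝ) : Measure (DataSet X J n) :=
  Measure.pi fun c => curveLaw ν σ (P c) (τ c) (meanVec μ α c t)

end

end FAnova

namespace FAnova

/-! Fix the covariates and a parameter θ. The logarithm of the t-density is a convex function of
‖z‖², so its tangent line at the actual error z bounds the density at every other random effect from
below by a Gaussian factor with weight w(z) (`emtdDensity_mul_exp_le`). The mixture over the
Gaussian process is then at least a Gaussian integral. This is estimated in the eigenbasis of K,
with the value that the Gibbs variational principle suggests for the trial law N(b, K(I + rK)⁻¹):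
the shift costs half the squared RKHS norm of b, the spread costs multiples of log|I + rK|
(`exp_le_integral_exp_multivariateGaussian`). On averaging over z, the term linear in z vanishes by
symmetry and the mean of w(z) does not depend on n. With r = σ⁻² this yields KL ≤ c₁ Σ (τ₀(u_l) -
b(u_l))² + c₂ log|I + σ⁻²K| + ‖b‖²/2 for every finite kernel combination b
(`klDensity_condDensity_predDensity_le`).

The estimator depends on the same data, and τ₀ need not lie in the RKHS of the estimated kernel. The
bound is therefore made uniform over a ball around θ₀ whose radius does not depend on n. A
combination Σ a_j k(·, x_j; θ₀) approximates τ₀ uniformly; for nearby θ the same a_j and x_j are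
used with the kernel of θ. Continuity and dominated convergence keep the mean squared error small,
and ‖b‖² stays bounded. The log-determinant is subadditive in the sample by Fischer's inequality, so
smallness of its expected supremum over the ball at one sample size, obtained from condition (A) and
continuity, passes to all large n (`exists_lintegral_envelope_logDetGram_le`).

Inside the ball the divergence is thus at most a function of the covariates alone, with small mean
(`exists_klDensity_le_near`). Outside, b = 0 gives a deterministic bound nC
(`exists_klDensity_le_mul`), and consistency makes the probability of this event vanish. Both limits
follow from this one bound. -/

/-! ### Gaussian integrals of quadratic exponentials -/

open Matrix in
/-- A standard Gaussian integral of a quadratic exponential, by completing the square. -/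
theorem integral_exp_neg_mul_sq_gaussianReal {w : ℝ} (hw : 0 ≤ w) (y a : ℝ) :
    ∫ x, Real.exp (-(w * (y - a * x) ^ 2)) ∂gaussianReal 0 1
      = (√(1 + 2 * w * a ^ 2))⁻¹ * Real.exp (-(w * y ^ 2 / (1 + 2 * w * a ^ 2))) := by
  set D := 1 + 2 * w * a ^ 2 with hD
  have hD0 : 0 < D := by positivity
  rw [integral_gaussianReal_eq_integral_smul one_ne_zero]
  have h1 : ∀ x : ℝ, gaussianPDFReal 0 1 x • Real.exp (-(w * (y - a * x) ^ 2))
      = ((√(2 * Real.pi))⁻¹ * Real.exp (-(w * y ^ 2 / D)))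
        * Real.exp (-(D / 2) * (x - 2 * w * a * y / D) ^ 2) := by
    intro x
    simp only [gaussianPDFReal, smul_eq_mul, NNReal.coe_one, mul_one, sub_zero]
    rw [mul_assoc, mul_assoc, ← Real.exp_add, ← Real.exp_add]
    congr 2
    field_simp
    rw [hD]
    ring
  simp_rw [h1]
  rw [integral_const_mul, integral_sub_right_eq_self
    (fun x : ℝ => Real.exp (-(D / 2) * x ^ 2)) (2 * w * a * y / D), integral_gaussian]
  have h2 : √(Real.pi / (D / 2)) = √(2 * Real.pi) * (√D)⁻¹ := by
    rw [← Real.sqrt_inv, ← Real.sqrt_mul (by positivity)]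
    congr 1
    field_simp
  rw [h2]
  have : √(2 * Real.pi) ≠ 0 := by positivity
  field_simp

/-- The exact integral is compared with the value given by a trial Gaussian of mean `h` and variance
`1 / (1 + r * a ^ 2)`. This variance does not depend on `w`, so the bound is affine in `w` and can
later be averaged over the random weight. -/
theorem exp_le_integral_exp_gaussianReal {w : ℝ} (hw : 0 ≤ w) {r : ℝ} (hr : 0 ≤ r)
    (y a h : ℝ) :
    Real.exp (-(w * ((y - a * h) ^ 2 + a ^ 2 / (1 + r * a ^ 2)) + h ^ 2 / 2
        + Real.log (1 + r * a ^ 2) / 2))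
      ≤ ∫ x, Real.exp (-(w * (y - a * x) ^ 2)) ∂gaussianReal 0 1 := by
  rw [integral_exp_neg_mul_sq_gaussianReal hw]
  set D := 1 + 2 * w * a ^ 2 with hD
  have hD0 : 0 < D := by positivity
  set E := 1 + r * a ^ 2 with hE
  have hE0 : 0 < E := by positivity
  have hE1 : 1 ≤ E := by rw [hE]; nlinarith [mul_nonneg hr (sq_nonneg a)]
  have h3 : (√D)⁻¹ = Real.exp (-(Real.log D / 2)) := by
    rw [Real.exp_neg, ← Real.log_sqrt hD0.le, Real.exp_log (Real.sqrt_pos.2 hD0)]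
  rw [h3, ← Real.exp_add, Real.exp_le_exp]
  -- The left side is the minimum of the right side over `h`; the difference, times `D`, is half the
  -- square given to `nlinarith`.
  have h4 : w * y ^ 2 / D ≤ w * (y - a * h) ^ 2 + h ^ 2 / 2 := by
    rw [div_le_iff₀ hD0, hD]
    nlinarith [sq_nonneg (2 * w * (y - a * h) * a - h)]
  have h5 : Real.log D / 2 ≤ w * (a ^ 2 / E) + Real.log E / 2 := by
    have h6 := Real.log_le_sub_one_of_pos (div_pos hD0 hE0)
    rw [Real.log_div hD0.ne' hE0.ne'] at h6
    have h7 : D / E - 1 ≤ 2 * (w * (a ^ 2 / E)) := by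
      rw [div_sub_one hE0.ne', ← mul_div_assoc, ← mul_div_assoc]
      apply div_le_div_of_nonneg_right _ hE0.le
      rw [hD]; nlinarith
    linarith
  nlinarith

-- Up to a power of `-r`, the determinant is the characteristic polynomial of `K` at `-r⁻¹`, which
-- is why `r = 0` is treated apart.
open Matrix in
theorem det_one_add_smul {n : Type*} [Fintype n] [DecidableEq n] {K : Matrix n n ℝ}
    (hK : K.IsHermitian) (r : ℝ) :
    (1 + r • K).det = ∏ i, (1 + r * hK.eigenvalues i) := by
  rcases eq_or_ne r 0 with rfl | hr
  · simp
  have h1 : (1 + r • K) = (-r) • (Matrix.scalar n (-r⁻¹) - K) := by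
    ext i j
    rcases eq_or_ne i j with rfl | hij
    · simp only [Matrix.add_apply, Matrix.one_apply_eq, Matrix.smul_apply, smul_eq_mul,
        Matrix.sub_apply, Matrix.scalar_apply, Matrix.diagonal_apply_eq]
      field_simp
      ring
    · simp [hij]
  rw [h1, Matrix.det_smul, ← Matrix.eval_charpoly, hK.charpoly_eq, Polynomial.eval_prod]
  simp only [Polynomial.eval_sub, Polynomial.eval_X, Polynomial.eval_C]
  rw [← Finset.card_univ, ← Finset.prod_const, ← Finset.prod_mul_distrib]
  refine Finset.prod_congr rfl fun i _ => ?_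
  simp only [RCLike.ofReal_real_eq_id, id]
  field_simp
  ring

theorem log_det_one_add_smul {n : Type*} [Fintype n] [DecidableEq n] {K : Matrix n n ℝ}
    (hK : K.PosSemidef) {r : ℝ} (hr : 0 ≤ r) :
    Real.log (1 + r • K).det = ∑ i, Real.log (1 + r * hK.1.eigenvalues i) := by
  rw [det_one_add_smul hK.1, Real.log_prod]
  intro i _
  have := mul_nonneg hr (hK.eigenvalues_nonneg i)
  positivity

theorem log_det_one_add_smul_nonneg {n : Type*} [Fintype n] [DecidableEq n] {K : Matrix n n ℝ}
    (hK : K.PosSemidef) {r : ℝ} (hr : 0 ≤ r) : 0 ≤ Real.log (1 + r • K).det := by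
  rw [log_det_one_add_smul hK hr]
  exact Finset.sum_nonneg fun i _ => Real.log_nonneg
    (by linarith [mul_nonneg hr (hK.eigenvalues_nonneg i)])

theorem log_det_one_add_smul_le_trace {n : Type*} [Fintype n] [DecidableEq n]
    {K : Matrix n n ℝ} (hK : K.PosSemidef) {r : ℝ} (hr : 0 ≤ r) :
    Real.log (1 + r • K).det ≤ r * K.trace := by
  rw [log_det_one_add_smul hK hr, hK.1.trace_eq_sum_eigenvalues, Finset.mul_sum]
  refine Finset.sum_le_sum fun i _ => ?_
  have h := mul_nonneg hr (hK.eigenvalues_nonneg i)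
  have := Real.log_le_sub_one_of_pos (show 0 < 1 + r * hK.1.eigenvalues i by positivity)
  simp only [RCLike.ofReal_real_eq_id, id]
  linarith

open Matrix RealInnerProductSpace in
theorem dotProduct_mulVec_eq_sum_eigenvalues {n : Type*} [Fintype n] [DecidableEq n]
    {K : Matrix n n ℝ} (hK : K.PosSemidef) (t : EuclideanSpace ℝ n) :
    t.ofLp ⬝ᵥ K *ᵥ t.ofLp
      = ∑ i, hK.1.eigenvalues i * ⟪hK.1.eigenvectorBasis i, t⟫ ^ 2 := by
  set v := hK.1.eigenvectorBasis
  have h1 : t.ofLp ⬝ᵥ K *ᵥ t.ofLp = ⟪t, WithLp.toLp 2 (K *ᵥ t.ofLp)⟫ := by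
    rw [EuclideanSpace.inner_eq_star_dotProduct]
    simp [dotProduct_comm]
  rw [h1, ← v.sum_inner_mul_inner]
  refine Finset.sum_congr rfl fun i _ => ?_
  have h2 : ⟪v i, WithLp.toLp 2 (K *ᵥ t.ofLp)⟫ = hK.1.eigenvalues i * ⟪v i, t⟫ := by
    rw [EuclideanSpace.inner_eq_star_dotProduct, EuclideanSpace.inner_eq_star_dotProduct]
    simp only [star_trivial]
    rw [dotProduct_comm, Matrix.dotProduct_mulVec, ← Matrix.mulVec_transpose,
      show Kᵀ = K by simpa [Matrix.IsHermitian] using! hK.1, hK.1.mulVec_eigenvectorBasis]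
    rw [smul_dotProduct, dotProduct_comm, smul_eq_mul]
  rw [h2, real_inner_comm]
  ring

open Matrix RealInnerProductSpace in
/-- A centred Gaussian vector in the orthonormal eigenbasis of its covariance matrix. -/
theorem multivariateGaussian_zero_eq_map {n : Type*} [Fintype n] [DecidableEq n]
    {K : Matrix n n ℝ} (hK : K.PosSemidef) :
    multivariateGaussian 0 K = (Measure.pi fun _ : n => gaussianReal 0 1).map
      fun x => ∑ i, (√(hK.1.eigenvalues i) * x i) • hK.1.eigenvectorBasis i := by
  have hm : Measurable fun x : n → ℝ =>
      ∑ i, (√(hK.1.eigenvalues i) * x i) • hK.1.eigenvectorBasis i := by fun_prop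
  have : IsProbabilityMeasure ((Measure.pi fun _ : n => gaussianReal 0 1).map
      fun x => ∑ i, (√(hK.1.eigenvalues i) * x i) • hK.1.eigenvectorBasis i) :=
    Measure.isProbabilityMeasure_map hm.aemeasurable
  apply Measure.ext_of_charFun
  ext t
  rw [charFun_multivariateGaussian hK, charFun_apply, integral_map hm.aemeasurable
    (Measurable.aestronglyMeasurable (by fun_prop))]
  set v := hK.1.eigenvectorBasis
  have hq : t.ofLp ⬝ᵥ K *ᵥ t.ofLp = ∑ i, hK.1.eigenvalues i * ⟪v i, t⟫ ^ 2 :=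
    dotProduct_mulVec_eq_sum_eigenvalues hK t
  have hx : ∀ x : n → ℝ, Complex.exp (⟪∑ i, (√(hK.1.eigenvalues i) * x i) • v i, t⟫ * Complex.I)
      = ∏ i, Complex.exp (((√(hK.1.eigenvalues i) * ⟪v i, t⟫ : ℝ) : ℂ) * x i * Complex.I) := by
    intro x
    rw [← Complex.exp_sum, ← Finset.sum_mul, sum_inner]
    congr 2
    push_cast
    refine Finset.sum_congr rfl fun i _ => ?_
    rw [real_inner_smul_left]
    push_cast
    ring
  simp_rw [hx]
  rw [integral_fintype_prod_eq_prod (f := fun i (x : ℝ) =>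
    Complex.exp (((√(hK.1.eigenvalues i) * ⟪v i, t⟫ : ℝ) : ℂ) * x * Complex.I))]
  simp_rw [← charFun_apply_real, charFun_gaussianReal]
  rw [← Complex.exp_sum, inner_zero_right, ← Complex.ofReal_ofNat, ← Complex.ofReal_div, hq]
  congr 1
  simp only [Complex.ofReal_zero, zero_mul, mul_zero, zero_sub, NNReal.coe_one, Complex.ofReal_one, one_mul]
  rw [Finset.sum_neg_distrib]
  push_cast
  rw [Finset.sum_div]
  congr 1
  refine Finset.sum_congr rfl fun i _ => ?_
  rw [mul_pow, ← Complex.ofReal_pow, ← Complex.ofReal_pow, Real.sq_sqrt (hK.eigenvalues_nonneg i)]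

open Matrix RealInnerProductSpace in
/-- A variational lower bound for Gaussian integrals of quadratic exponentials. The hypothesis `hb`
says that `b` lies in the Cameron-Martin space of `N(0, K)`, with squared norm at most `F`. -/
theorem exp_le_integral_exp_multivariateGaussian {n : Type*} [Fintype n] [DecidableEq n]
    {K : Matrix n n ℝ} (hK : K.PosSemidef) {w : ℝ} (hw : 0 ≤ w) {r : ℝ} (hr : 0 < r)
    (y b : EuclideanSpace ℝ n) {F : ℝ} (hF : 0 ≤ F)
    (hb : ∀ v : EuclideanSpace ℝ n, ⟪v, b⟫ ^ 2 ≤ (v.ofLp ⬝ᵥ K *ᵥ v.ofLp) * F) :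
    Real.exp (-(w * (‖y - b‖ ^ 2 + Real.log (1 + r • K).det / r) + F / 2
        + Real.log (1 + r • K).det / 2))
      ≤ ∫ t, Real.exp (-(w * ‖y - t‖ ^ 2)) ∂multivariateGaussian 0 K := by
  set v := hK.1.eigenvectorBasis with hv
  set lam := hK.1.eigenvalues with hlam
  have hlam0 : ∀ i, 0 ≤ lam i := hK.eigenvalues_nonneg
  have hq : ∀ t : EuclideanSpace ℝ n, t.ofLp ⬝ᵥ K *ᵥ t.ofLp = ∑ i, lam i * ⟪v i, t⟫ ^ 2 :=
    dotProduct_mulVec_eq_sum_eigenvalues hK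
  have hm : Measurable fun x : n → ℝ => ∑ i, (√(lam i) * x i) • v i := by fun_prop
  have hnorm : ∀ z : EuclideanSpace ℝ n, ‖z‖ ^ 2 = ∑ i, ⟪v i, z⟫ ^ 2 := fun z =>
    (v.sum_sq_inner_right z).symm
  rw [multivariateGaussian_zero_eq_map hK, integral_map hm.aemeasurable
    (Continuous.aestronglyMeasurable (by fun_prop))]
  -- In the eigenbasis the integrand factorises, which reduces the bound to one dimension.
  have hx : ∀ x : n → ℝ, Real.exp (-(w * ‖y - ∑ i, (√(lam i) * x i) • v i‖ ^ 2))
      = ∏ i, Real.exp (-(w * (⟪v i, y⟫ - √(lam i) * x i) ^ 2)) := by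
    intro x
    rw [← Real.exp_sum, hnorm, Finset.mul_sum, ← Finset.sum_neg_distrib]
    congr 1
    refine Finset.sum_congr rfl fun i _ => ?_
    rw [inner_sub_right, v.orthonormal.inner_right_fintype]
  simp_rw [hx]
  rw [integral_fintype_prod_eq_prod (f := fun i (x : ℝ) =>
    Real.exp (-(w * (⟪v i, y⟫ - √(lam i) * x) ^ 2)))]
  -- These are the coordinates of K^(-1/2) b. Where the eigenvalue is zero the quotient is 0 by
  -- convention, and `hzero` shows that b has no component there.
  set h : n → ℝ := fun i => ⟪v i, b⟫ / √(lam i) with hh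
  have hsq : ∀ i, √(lam i) ^ 2 = lam i := fun i => Real.sq_sqrt (hlam0 i)
  have hzero : ∀ i, lam i = 0 → ⟪v i, b⟫ = 0 := by
    intro i hi
    have h1 := hb (v i)
    rw [hq] at h1
    have h2 : ∑ j, lam j * ⟪v j, v i⟫ ^ 2 = 0 := by
      refine Finset.sum_eq_zero fun j _ => ?_
      rcases eq_or_ne j i with rfl | hij
      · simp [hi]
      · simp [v.orthonormal.2 hij]
    rw [h2, zero_mul] at h1
    exact pow_eq_zero_iff two_ne_zero |>.1 (le_antisymm h1 (sq_nonneg _))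
  have hroot : ∀ i, √(lam i) * h i = ⟪v i, b⟫ := by
    intro i
    rcases (hlam0 i).eq_or_lt with h0 | h0
    · rw [hzero i h0.symm, ← h0]; simp
    · have := Real.sqrt_pos.2 h0
      simp only [hh]; field_simp
  have hhF : ∑ i, h i ^ 2 ≤ F := by
    -- Testing with the pseudo-inverse of K applied to b gives (Σ h²)² ≤ (Σ h²) F.
    have h1 := hb (∑ i, (⟪v i, b⟫ / lam i) • v i)
    rw [hq] at h1
    simp_rw [v.orthonormal.inner_right_fintype] at h1
    have h2 : ⟪∑ i, (⟪v i, b⟫ / lam i) • v i, b⟫ = ∑ i, h i ^ 2 := by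
      rw [sum_inner]
      refine Finset.sum_congr rfl fun i _ => ?_
      rw [real_inner_smul_left, hh, div_pow, hsq]; ring
    have h3 : ∑ i, lam i * (⟪v i, b⟫ / lam i) ^ 2 = ∑ i, h i ^ 2 := by
      refine Finset.sum_congr rfl fun i _ => ?_
      simp only [hh, div_pow, hsq]
      rcases (hlam0 i).eq_or_lt with h0 | h0
      · simp [← h0]
      · field_simp
    rw [h2, h3] at h1
    have h4 : 0 ≤ ∑ i, h i ^ 2 := Finset.sum_nonneg fun i _ => sq_nonneg _
    nlinarith
  calc
    _ ≤ Real.exp (∑ i, -(w * ((⟪v i, y⟫ - √(lam i) * h i) ^ 2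
          + √(lam i) ^ 2 / (1 + r * √(lam i) ^ 2)) + h i ^ 2 / 2
          + Real.log (1 + r * √(lam i) ^ 2) / 2)) := by
        rw [Real.exp_le_exp, Finset.sum_neg_distrib, neg_le_neg_iff, Finset.sum_add_distrib,
          Finset.sum_add_distrib, ← Finset.mul_sum, Finset.sum_add_distrib, ← Finset.sum_div,
          ← Finset.sum_div, log_det_one_add_smul hK hr.le]
        simp_rw [hroot, hsq, ← inner_sub_right]
        rw [← hnorm]
        -- The trace of the trial covariance is absorbed into the log-determinant by 1 - 1/x ≤ log x
        -- at x = 1 + rλ.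
        have h5 : ∑ i, lam i / (1 + r * lam i) ≤ (∑ i, Real.log (1 + r * lam i)) / r := by
          rw [Finset.sum_div]
          refine Finset.sum_le_sum fun i _ => ?_
          have hp : 0 < 1 + r * lam i := by have := mul_nonneg hr.le (hlam0 i); positivity
          have h6 := Real.one_sub_inv_le_log_of_pos hp
          rw [le_div_iff₀ hr]
          refine le_trans (le_of_eq ?_) h6
          have := hp.ne'
          rw [div_mul_eq_mul_div, inv_eq_one_div, one_sub_div this]
          congr 1
          ring
        have := mul_le_mul_of_nonneg_left h5 hw
        linarith
    _ = ∏ i, Real.exp (-(w * ((⟪v i, y⟫ - √(lam i) * h i) ^ 2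
          + √(lam i) ^ 2 / (1 + r * √(lam i) ^ 2)) + h i ^ 2 / 2
          + Real.log (1 + r * √(lam i) ^ 2) / 2)) := Real.exp_sum _ _
    _ ≤ _ := Finset.prod_le_prod (fun i _ => (Real.exp_pos _).le) fun i _ =>
        exp_le_integral_exp_gaussianReal hw hr.le _ _ _

/-! ### From a bound on the log-ratio to a bound on the divergence -/

/-- An upper bound on the logarithm of the ratio of two densities bounds their divergence. -/
theorem klDensity_le_of_le_mul_exp {n : ℕ} {f g G : (Fin n → ℝ) → ℝ}
    (hf : Measurable f) (hg : Measurable g) (hf0 : ∀ y, 0 < f y) (hg0 : ∀ y, 0 < g y)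
    (hf1 : ∫⁻ y, ENNReal.ofReal (f y) = 1) (hg1 : ∫⁻ y, ENNReal.ofReal (g y) = 1)
    (hle : ∀ y, f y ≤ g y * Real.exp (G y)) (hint : Integrable fun y => f y * G y) :
    klDensity f g ≤ ENNReal.ofReal (∫ y, f y * G y) := by
  have integrable_of : ∀ {h : (Fin n → ℝ) → ℝ}, Measurable h → (∀ y, 0 < h y) →
      ∫⁻ y, ENNReal.ofReal (h y) = 1 → Integrable h ∧ ∫ y, h y = 1 := by
    intro h hm h0 h1
    have hi : Integrable h := by
      rw [← lintegral_ofReal_ne_top_iff_integrable hm.aestronglyMeasurable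
        (ae_of_all _ fun y => (h0 y).le), h1]
      exact ENNReal.one_ne_top
    refine ⟨hi, ?_⟩
    rw [integral_eq_lintegral_of_nonneg_ae (ae_of_all _ fun y => (h0 y).le)
      hm.aestronglyMeasurable, h1, ENNReal.toReal_one]
  obtain ⟨hfi, hfI⟩ := integrable_of hf hf0 hf1
  obtain ⟨hgi, hgI⟩ := integrable_of hg hg0 hg1
  have hfg : Measurable fun y => ENNReal.ofReal (f y / g y) := (hf.div hg).ennreal_ofReal
  set ν : Measure (Fin n → ℝ) := volume.withDensity fun y => ENNReal.ofReal (g y) with hν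
  have hμ : (volume.withDensity fun y => ENNReal.ofReal (f y))
      = ν.withDensity fun y => ENNReal.ofReal (f y / g y) := by
    rw [hν, ← withDensity_mul _ hg.ennreal_ofReal hfg]
    congr 1
    ext y
    rw [Pi.mul_apply, ← ENNReal.ofReal_mul (hg0 y).le, mul_div_cancel₀ _ (hg0 y).ne']
  have hνfin : IsProbabilityMeasure ν := ⟨by rw [hν, withDensity_apply _ .univ]; simpa using hg1⟩
  have hμfin : IsProbabilityMeasure (volume.withDensity fun y => ENNReal.ofReal (f y)) :=
    ⟨by rw [withDensity_apply _ .univ]; simpa using hf1⟩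
  have hac : (volume.withDensity fun y => ENNReal.ofReal (f y)) ≪ ν := by
    rw [hμ]; exact withDensity_absolutelyContinuous _ _
  -- The form with `klFun` is nonnegative, so it can be integrated without knowing beforehand that f
  -- log(f/g) is integrable; the extra term g - f integrates to zero.
  have hpt : ∀ y, g y * InformationTheory.klFun (f y / g y) ≤ f y * G y + g y - f y := by
    intro y
    have h1 : Real.log (f y / g y) ≤ G y := by
      rw [Real.log_le_iff_le_exp (div_pos (hf0 y) (hg0 y)), div_le_iff₀ (hg0 y), mul_comm]
      exact hle y
    have h2 : g y * InformationTheory.klFun (f y / g y)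
        = f y * Real.log (f y / g y) + g y - f y := by
      have := (hg0 y).ne'
      rw [InformationTheory.klFun_apply]
      field_simp
    rw [h2]
    have := mul_le_mul_of_nonneg_left h1 (hf0 y).le
    linarith
  have hkl0 : ∀ y, 0 ≤ g y * InformationTheory.klFun (f y / g y) := fun y =>
    mul_nonneg (hg0 y).le (InformationTheory.klFun_nonneg (div_pos (hf0 y) (hg0 y)).le)
  rw [klDensity, InformationTheory.klDiv_eq_lintegral_klFun_of_ac hac]
  calc
    _ = ∫⁻ y, ENNReal.ofReal (InformationTheory.klFun (f y / g y)) ∂ν := by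
      refine lintegral_congr_ae ?_
      have := Measure.rnDeriv_withDensity ν hfg
      rw [← hμ] at this
      filter_upwards [this] with y hy
      rw [hy, ENNReal.toReal_ofReal (div_pos (hf0 y) (hg0 y)).le]
    _ = ∫⁻ y, ENNReal.ofReal (g y * InformationTheory.klFun (f y / g y)) := by
      have hk : Measurable fun y => ENNReal.ofReal (InformationTheory.klFun (f y / g y)) :=
        (InformationTheory.measurable_klFun.comp (hf.div hg)).ennreal_ofReal
      rw [hν, lintegral_withDensity_eq_lintegral_mul _ hg.ennreal_ofReal hk]
      refine lintegral_congr fun y => ?_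
      rw [Pi.mul_apply, ENNReal.ofReal_mul (hg0 y).le]
    _ ≤ ∫⁻ y, ENNReal.ofReal (f y * G y + g y - f y) :=
      lintegral_mono fun y => ENNReal.ofReal_le_ofReal (hpt y)
    _ = ENNReal.ofReal (∫ y, f y * G y + g y - f y) :=
      (ofReal_integral_eq_lintegral_ofReal ((hint.add hgi).sub hfi)
        (ae_of_all _ fun y => (hkl0 y).trans (hpt y))).symm
    _ = _ := by
      have hadd : Integrable fun y => f y * G y + g y := hint.add hgi
      rw [integral_sub hadd hfi, integral_add hint hgi, hfI, hgI, add_sub_cancel_right]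

/-! ### Normalising constants -/

theorem lintegral_exp_neg_mul_sum_sq (n : ℕ) {b : ℝ} (hb : 0 < b) :
    ∫⁻ z : Fin n → ℝ, ENNReal.ofReal (Real.exp (-(b * ∑ l, z l ^ 2)))
      = ENNReal.ofReal ((Real.pi / b) ^ ((n : ℝ) / 2)) := by
  have h1 : ∀ z : Fin n → ℝ, Real.exp (-(b * ∑ l, z l ^ 2)) = ∏ l, Real.exp (-b * z l ^ 2) := by
    intro z
    rw [← Real.exp_sum, Finset.mul_sum, ← Finset.sum_neg_distrib]
    simp
  have h2 : Integrable fun z : Fin n → ℝ => ∏ l, Real.exp (-b * z l ^ 2) :=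
    Integrable.fintype_prod (f := fun _ x => Real.exp (-b * x ^ 2))
      fun _ => integrable_exp_neg_mul_sq hb
  simp_rw [h1]
  rw [← ofReal_integral_eq_lintegral_ofReal h2
    (ae_of_all _ fun z => Finset.prod_nonneg fun _ _ => (Real.exp_pos _).le),
    integral_fintype_prod_volume_eq_prod (f := fun _ x => Real.exp (-b * x ^ 2))]
  simp only [integral_gaussian, Finset.prod_const, Finset.card_univ, Fintype.card_fin]
  rw [Real.sqrt_eq_rpow, ← Real.rpow_natCast, ← Real.rpow_mul (by positivity)]
  congr 2
  ring

/-- The normalising constant of the multivariate t-density. -/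
theorem lintegral_one_add_sum_sq_rpow (n : ℕ) {ν c : ℝ} (hν : 0 < ν) (hc : 0 < c) :
    ∫⁻ z : Fin n → ℝ, ENNReal.ofReal ((1 + (∑ l, z l ^ 2) / c) ^ (-((n : ℝ) / 2 + ν)))
      = ENNReal.ofReal ((Real.pi * c) ^ ((n : ℝ) / 2)
          * (Real.Gamma ν / Real.Gamma ((n : ℝ) / 2 + ν))) := by
  set a := (n : ℝ) / 2 + ν with ha
  have ha0 : 0 < a := by positivity
  have hG := Real.Gamma_pos_of_pos ha0
  have gam : ∀ {a r : ℝ}, 0 < a → 0 < r →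
      ∫⁻ t in Set.Ioi 0, ENNReal.ofReal (t ^ (a - 1) * Real.exp (-(r * t)))
        = ENNReal.ofReal (r ^ (-a) * Real.Gamma a) := by
    intro a r ha hr
    have h1 := Real.integral_rpow_mul_exp_neg_mul_Ioi ha hr
    rw [one_div, Real.inv_rpow hr.le, ← Real.rpow_neg hr.le] at h1
    have hi : IntegrableOn (fun t : ℝ => t ^ (a - 1) * Real.exp (-(r * t))) (Set.Ioi 0) := by
      -- Integrability is read off from the value: the integral of a non-integrable function is 0 by
      -- convention, and the known value is positive.
      by_contra hcon
      rw [integral_undef hcon] at h1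
      have : 0 < r ^ (-a) * Real.Gamma a :=
        mul_pos (Real.rpow_pos_of_pos hr _) (Real.Gamma_pos_of_pos ha)
      exact this.ne h1
    rw [← h1, ofReal_integral_eq_lintegral_ofReal hi]
    filter_upwards [ae_restrict_mem measurableSet_Ioi] with t ht
    exact mul_nonneg (Real.rpow_nonneg (le_of_lt ht) _) (Real.exp_pos _).le
  -- The power is written as a Gamma integral, a scale mixture of Gaussians. After Tonelli, the
  -- Gaussian integral over z contributes t^(-n/2) and leaves a Gamma integral with exponent ν.
  have h1 : ∀ z : Fin n → ℝ, ENNReal.ofReal ((1 + (∑ l, z l ^ 2) / c) ^ (-a))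
      = ENNReal.ofReal (Real.Gamma a)⁻¹ * ∫⁻ t in Set.Ioi 0,
          ENNReal.ofReal (t ^ (a - 1) * Real.exp (-((1 + (∑ l, z l ^ 2) / c) * t))) := by
    intro z
    have : 0 ≤ ∑ l, z l ^ 2 := Finset.sum_nonneg fun _ _ => sq_nonneg _
    rw [gam ha0 (by positivity), ← ENNReal.ofReal_mul (by positivity)]
    congr 1
    field_simp
  simp_rw [h1]
  have hmeas : Measurable fun p : (Fin n → ℝ) × ℝ =>
      ENNReal.ofReal (p.2 ^ (a - 1) * Real.exp (-((1 + (∑ l, p.1 l ^ 2) / c) * p.2))) := by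
    fun_prop
  rw [lintegral_const_mul _ hmeas.lintegral_prod_right',
    lintegral_lintegral_swap hmeas.aemeasurable]
  have h2 : ∀ t ∈ Set.Ioi (0 : ℝ), ∫⁻ z : Fin n → ℝ,
      ENNReal.ofReal (t ^ (a - 1) * Real.exp (-((1 + (∑ l, z l ^ 2) / c) * t)))
      = ENNReal.ofReal ((Real.pi * c) ^ ((n : ℝ) / 2))
        * ENNReal.ofReal (t ^ (ν - 1) * Real.exp (-(1 * t))) := by
    intro t ht
    have ht : 0 < t := ht
    have h3 : ∀ z : Fin n → ℝ,
        ENNReal.ofReal (t ^ (a - 1) * Real.exp (-((1 + (∑ l, z l ^ 2) / c) * t)))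
        = ENNReal.ofReal (t ^ (a - 1) * Real.exp (-(1 * t)))
          * ENNReal.ofReal (Real.exp (-(t / c * ∑ l, z l ^ 2))) := by
      intro z
      rw [← ENNReal.ofReal_mul (by positivity), mul_assoc, ← Real.exp_add]
      congr 3
      ring
    simp_rw [h3]
    rw [lintegral_const_mul _ (by fun_prop), lintegral_exp_neg_mul_sum_sq n (by positivity),
      ← ENNReal.ofReal_mul (by positivity), ← ENNReal.ofReal_mul (by positivity)]
    congr 1
    have h4 : Real.pi / (t / c) = Real.pi * c / t := by field_simp
    rw [h4, Real.div_rpow (by positivity) ht.le, show a - 1 = (ν - 1) + (n : ℝ) / 2 by rw [ha]; ring,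
      Real.rpow_add ht]
    have := (Real.rpow_pos_of_pos ht ((n : ℝ) / 2)).ne'
    field_simp
  rw [setLIntegral_congr_fun measurableSet_Ioi h2, lintegral_const_mul _ (by fun_prop),
    gam hν one_pos, ← ENNReal.ofReal_mul (by positivity), ← ENNReal.ofReal_mul (by positivity)]
  congr 1
  rw [Real.one_rpow]
  field_simp

/-! ### The t-density: tangent bound and moments of the weight -/

section emtd

variable {ν σ : ℝ} {n : ℕ}

theorem emtdDensity_pos (hν : 1 < ν) (hσ : 0 < σ) (z : Fin n → ℝ) : 0 < emtdDensity ν σ z := by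
  have h1 : 0 < ν - 1 := by linarith
  have hA : 0 < (n : ℝ) / 2 + ν := by positivity
  have h2 : 0 ≤ ∑ l, z l ^ 2 := Finset.sum_nonneg fun _ _ => sq_nonneg _
  have h3 := Real.Gamma_pos_of_pos hA
  have h4 := Real.Gamma_pos_of_pos (show 0 < ν by linarith)
  unfold emtdDensity
  positivity

theorem measurable_emtdDensity : Measurable (emtdDensity ν σ : (Fin n → ℝ) → ℝ) := by
  unfold emtdDensity
  fun_prop

theorem emtdDensity_neg (z : Fin n → ℝ) : emtdDensity ν σ (-z) = emtdDensity ν σ z := by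
  simp [emtdDensity]

theorem lintegral_emtdDensity (hν : 1 < ν) (hσ : 0 < σ) :
    ∫⁻ z : Fin n → ℝ, ENNReal.ofReal (emtdDensity ν σ z) = 1 := by
  have h1 : 0 < ν - 1 := by linarith
  have hA : 0 < (n : ℝ) / 2 + ν := by positivity
  have h3 := Real.Gamma_pos_of_pos hA
  have h4 := Real.Gamma_pos_of_pos (show 0 < ν by linarith)
  have hc : 0 < 2 * (ν - 1) * σ ^ 2 := by positivity
  unfold emtdDensity
  simp_rw [ENNReal.ofReal_mul (show (0 : ℝ) ≤ (2 * Real.pi * (ν - 1) * σ ^ 2) ^ (-((n : ℝ) / 2))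
    * (Real.Gamma ((n : ℝ) / 2 + ν) / Real.Gamma ν) by positivity)]
  rw [lintegral_const_mul _ (by fun_prop), lintegral_one_add_sum_sq_rpow n (by linarith) hc,
    ← ENNReal.ofReal_mul (by positivity), ENNReal.ofReal_eq_one,
    show Real.pi * (2 * (ν - 1) * σ ^ 2) = 2 * Real.pi * (ν - 1) * σ ^ 2 by ring,
    Real.rpow_neg (by positivity)]
  have : (2 * Real.pi * (ν - 1) * σ ^ 2) ^ ((n : ℝ) / 2) ≠ 0 := by positivity
  field_simp

theorem integrable_emtdDensity (hν : 1 < ν) (hσ : 0 < σ) :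
    Integrable (emtdDensity ν σ : (Fin n → ℝ) → ℝ) := by
  rw [← lintegral_ofReal_ne_top_iff_integrable measurable_emtdDensity.aestronglyMeasurable
    (ae_of_all _ fun y => (emtdDensity_pos hν hσ y).le), lintegral_emtdDensity hν hσ]
  exact ENNReal.one_ne_top

theorem integral_emtdDensity (hν : 1 < ν) (hσ : 0 < σ) :
    ∫ z : Fin n → ℝ, emtdDensity ν σ z = 1 := by
  rw [integral_eq_lintegral_of_nonneg_ae (ae_of_all _ fun y => (emtdDensity_pos hν hσ y).le)
    measurable_emtdDensity.aestronglyMeasurable, lintegral_emtdDensity hν hσ, ENNReal.toReal_one]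

/-- The derivative of `-log` of the t-density with respect to `‖z‖²`. -/
noncomputable def emtdWeight (ν σ : ℝ) {n : ℕ} (z : Fin n → ℝ) : ℝ :=
  ((n : ℝ) / 2 + ν) / (2 * (ν - 1) * σ ^ 2 + ∑ l, z l ^ 2)

theorem emtdWeight_nonneg (hν : 1 < ν) (hσ : 0 < σ) (z : Fin n → ℝ) : 0 ≤ emtdWeight ν σ z := by
  have h1 : 0 < ν - 1 := by linarith
  have h2 : 0 ≤ ∑ l, z l ^ 2 := Finset.sum_nonneg fun _ _ => sq_nonneg _
  unfold emtdWeight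
  positivity

theorem measurable_emtdWeight : Measurable (emtdWeight ν σ : (Fin n → ℝ) → ℝ) := by
  unfold emtdWeight
  fun_prop

/-- The log-density is convex in the squared norm, and this is its tangent line at the squared norm
of `z`. As a function of `z'` the bound is a Gaussian exponential. -/
theorem emtdDensity_mul_exp_le (hν : 1 < ν) (hσ : 0 < σ) (z z' : Fin n → ℝ) :
    emtdDensity ν σ z * Real.exp (-(emtdWeight ν σ z * (∑ l, z' l ^ 2 - ∑ l, z l ^ 2)))
      ≤ emtdDensity ν σ z' := by
  have h1 : 0 < ν - 1 := by linarith
  have hA : 0 < (n : ℝ) / 2 + ν := by positivity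
  have hq : 0 ≤ ∑ l, z l ^ 2 := Finset.sum_nonneg fun _ _ => sq_nonneg _
  have hq' : 0 ≤ ∑ l, z' l ^ 2 := Finset.sum_nonneg fun _ _ => sq_nonneg _
  have h3 := Real.Gamma_pos_of_pos hA
  have h4 := Real.Gamma_pos_of_pos (show 0 < ν by linarith)
  unfold emtdDensity emtdWeight
  set c := 2 * (ν - 1) * σ ^ 2 with hc
  have hc0 : 0 < c := by positivity
  rw [mul_assoc]
  refine mul_le_mul_of_nonneg_left ?_ (by positivity)
  have hz : 0 < 1 + (∑ l, z l ^ 2) / c := by positivity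
  have hz' : 0 < 1 + (∑ l, z' l ^ 2) / c := by positivity
  rw [Real.rpow_def_of_pos hz, Real.rpow_def_of_pos hz', ← Real.exp_add, Real.exp_le_exp]
  have h5 := Real.log_le_sub_one_of_pos (div_pos hz' hz)
  rw [Real.log_div hz'.ne' hz.ne'] at h5
  have h6 : (1 + (∑ l, z' l ^ 2) / c) / (1 + (∑ l, z l ^ 2) / c) - 1
      = (∑ l, z' l ^ 2 - ∑ l, z l ^ 2) / (c + ∑ l, z l ^ 2) := by
    have : c + ∑ l, z l ^ 2 ≠ 0 := by positivity
    field_simp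
    ring
  rw [h6] at h5
  have := mul_le_mul_of_nonneg_left h5 hA.le
  rw [div_mul_eq_mul_div, mul_div_assoc]
  linarith

/-- The weight lowers the exponent by one, which replaces ν by ν + 1 in the normalising integral.
The Gamma recursion then cancels the factor n/2 + ν, so the mean weight does not grow with `n`. -/
theorem lintegral_emtdDensity_mul_emtdWeight (hν : 1 < ν) (hσ : 0 < σ) :
    ∫⁻ z : Fin n → ℝ, ENNReal.ofReal (emtdDensity ν σ z * emtdWeight ν σ z)
      = ENNReal.ofReal (ν / (2 * (ν - 1) * σ ^ 2)) := by
  have h1 : 0 < ν - 1 := by linarith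
  have hν0 : 0 < ν := by linarith
  have hA : 0 < (n : ℝ) / 2 + ν := by positivity
  have h3 := Real.Gamma_pos_of_pos hA
  have h4 := Real.Gamma_pos_of_pos hν0
  have hc : 0 < 2 * (ν - 1) * σ ^ 2 := by positivity
  have h5 : ∀ z : Fin n → ℝ, emtdDensity ν σ z * emtdWeight ν σ z
      = ((2 * Real.pi * (ν - 1) * σ ^ 2) ^ (-((n : ℝ) / 2))
          * (Real.Gamma ((n : ℝ) / 2 + ν) / Real.Gamma ν)
          * (((n : ℝ) / 2 + ν) / (2 * (ν - 1) * σ ^ 2)))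
        * (1 + (∑ l, z l ^ 2) / (2 * (ν - 1) * σ ^ 2)) ^ (-((n : ℝ) / 2 + (ν + 1))) := by
    intro z
    have hq : 0 ≤ ∑ l, z l ^ 2 := Finset.sum_nonneg fun _ _ => sq_nonneg _
    have hz : 0 < 1 + (∑ l, z l ^ 2) / (2 * (ν - 1) * σ ^ 2) := by positivity
    rw [show -((n : ℝ) / 2 + (ν + 1)) = -((n : ℝ) / 2 + ν) - 1 by ring, Real.rpow_sub_one hz.ne']
    unfold emtdDensity emtdWeight
    generalize (2 * Real.pi * (ν - 1) * σ ^ 2) ^ (-((n : ℝ) / 2)) = P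
    generalize (1 + (∑ l, z l ^ 2) / (2 * (ν - 1) * σ ^ 2)) ^ (-((n : ℝ) / 2 + ν)) = Q
    set c := 2 * (ν - 1) * σ ^ 2
    have : c + ∑ l, z l ^ 2 ≠ 0 := by positivity
    field_simp
  simp_rw [h5]
  simp_rw [ENNReal.ofReal_mul (show (0 : ℝ) ≤ (2 * Real.pi * (ν - 1) * σ ^ 2) ^ (-((n : ℝ) / 2))
    * (Real.Gamma ((n : ℝ) / 2 + ν) / Real.Gamma ν)
    * (((n : ℝ) / 2 + ν) / (2 * (ν - 1) * σ ^ 2)) by positivity)]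
  rw [lintegral_const_mul _ (by fun_prop),
    lintegral_one_add_sum_sq_rpow n (show 0 < ν + 1 by linarith) hc,
    ← ENNReal.ofReal_mul (by positivity),
    show Real.pi * (2 * (ν - 1) * σ ^ 2) = 2 * Real.pi * (ν - 1) * σ ^ 2 by ring,
    Real.rpow_neg (by positivity), Real.Gamma_add_one hν0.ne',
    show (n : ℝ) / 2 + (ν + 1) = (n : ℝ) / 2 + ν + 1 by ring, Real.Gamma_add_one hA.ne']
  have : (2 * Real.pi * (ν - 1) * σ ^ 2) ^ ((n : ℝ) / 2) ≠ 0 := by positivity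
  congr 1
  generalize (2 * Real.pi * (ν - 1) * σ ^ 2) ^ ((n : ℝ) / 2) = P at *
  generalize hAA : (n : ℝ) / 2 + ν = A at *
  field_simp

theorem integrable_emtdDensity_mul_emtdWeight (hν : 1 < ν) (hσ : 0 < σ) :
    Integrable fun z : Fin n → ℝ => emtdDensity ν σ z * emtdWeight ν σ z := by
  have hm : Measurable fun z : Fin n → ℝ => emtdDensity ν σ z * emtdWeight ν σ z :=
    measurable_emtdDensity.mul measurable_emtdWeight
  rw [← lintegral_ofReal_ne_top_iff_integrable hm.aestronglyMeasurable
    (ae_of_all _ fun y => mul_nonneg (emtdDensity_pos hν hσ y).le (emtdWeight_nonneg hν hσ y)),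
    lintegral_emtdDensity_mul_emtdWeight hν hσ]
  exact ENNReal.ofReal_ne_top

theorem integral_emtdDensity_mul_emtdWeight (hν : 1 < ν) (hσ : 0 < σ) :
    ∫ z : Fin n → ℝ, emtdDensity ν σ z * emtdWeight ν σ z = ν / (2 * (ν - 1) * σ ^ 2) := by
  have h1 : 0 < ν - 1 := by linarith
  rw [integral_eq_lintegral_of_nonneg_ae
    (ae_of_all _ fun y => mul_nonneg (emtdDensity_pos hν hσ y).le (emtdWeight_nonneg hν hσ y))
    (measurable_emtdDensity.mul measurable_emtdWeight).aestronglyMeasurable,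
    lintegral_emtdDensity_mul_emtdWeight hν hσ, ENNReal.toReal_ofReal (by positivity)]

/-- The weight times the squared norm is at most n/2 + ν, so after |z·d| ≤ ‖z‖² + ‖d‖² only the
density and the weighted density have to be integrable. -/
theorem integrable_emtdDensity_mul_emtdWeight_mul (hν : 1 < ν) (hσ : 0 < σ) (d : Fin n → ℝ) :
    Integrable fun z : Fin n → ℝ =>
      emtdDensity ν σ z * emtdWeight ν σ z * ∑ l, z l * d l := by
  have h1 : 0 < ν - 1 := by linarith
  have hA : 0 < (n : ℝ) / 2 + ν := by positivity
  have hdom := ((integrable_emtdDensity (n := n) hν hσ).const_mul ((n : ℝ) / 2 + ν)).add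
    ((integrable_emtdDensity_mul_emtdWeight (n := n) hν hσ).mul_const (∑ l, d l ^ 2))
  refine hdom.mono' (Measurable.aestronglyMeasurable ((measurable_emtdDensity.mul
    measurable_emtdWeight).mul (by fun_prop))) (ae_of_all _ fun z => ?_)
  have he := (emtdDensity_pos hν hσ z).le
  have hw := emtdWeight_nonneg hν hσ z
  have hq : 0 ≤ ∑ l, z l ^ 2 := Finset.sum_nonneg fun _ _ => sq_nonneg _
  have h2 : |∑ l, z l * d l| ≤ ∑ l, z l ^ 2 + ∑ l, d l ^ 2 := by
    refine (Finset.abs_sum_le_sum_abs _ _).trans ?_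
    rw [← Finset.sum_add_distrib]
    refine Finset.sum_le_sum fun l _ => abs_le.2 ⟨?_, ?_⟩ <;>
      nlinarith [sq_nonneg (z l + d l), sq_nonneg (z l - d l), sq_nonneg (z l), sq_nonneg (d l)]
  have h3 : emtdWeight ν σ z * ∑ l, z l ^ 2 ≤ (n : ℝ) / 2 + ν := by
    unfold emtdWeight
    rw [div_mul_eq_mul_div, div_le_iff₀ (by positivity)]
    have : 0 ≤ 2 * (ν - 1) * σ ^ 2 := by positivity
    nlinarith
  rw [Real.norm_eq_abs, abs_mul, abs_of_nonneg (mul_nonneg he hw)]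
  simp only [Pi.add_apply]
  calc emtdDensity ν σ z * emtdWeight ν σ z * |∑ l, z l * d l|
      ≤ emtdDensity ν σ z * emtdWeight ν σ z * (∑ l, z l ^ 2 + ∑ l, d l ^ 2) :=
        mul_le_mul_of_nonneg_left h2 (mul_nonneg he hw)
    _ = emtdDensity ν σ z * (emtdWeight ν σ z * ∑ l, z l ^ 2)
        + emtdDensity ν σ z * emtdWeight ν σ z * ∑ l, d l ^ 2 := by ring
    _ ≤ _ := by
      have := mul_le_mul_of_nonneg_left h3 he
      linarith

/-- The integrand is odd. This removes the cross term between the error and the approximation error.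
-/
theorem integral_emtdDensity_mul_emtdWeight_mul (d : Fin n → ℝ) :
    ∫ z : Fin n → ℝ, emtdDensity ν σ z * emtdWeight ν σ z * ∑ l, z l * d l = 0 := by
  have h := integral_neg_eq_self
    (fun z : Fin n → ℝ => emtdDensity ν σ z * emtdWeight ν σ z * ∑ l, z l * d l) volume
  have h2 : ∀ z : Fin n → ℝ, emtdDensity ν σ (-z) * emtdWeight ν σ (-z) * ∑ l, (-z) l * d l
      = -(emtdDensity ν σ z * emtdWeight ν σ z * ∑ l, z l * d l) := by
    intro z
    simp [emtdDensity_neg, emtdWeight]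
  simp_rw [h2] at h
  rw [integral_neg] at h
  linarith

end emtd

/-! ### The predictive density and the divergence bound at a fixed parameter -/

section pred

variable {ν σ : ℝ} {n : ℕ}

theorem emtdDensity_le (hν : 1 < ν) (hσ : 0 < σ) (z : Fin n → ℝ) :
    emtdDensity ν σ z ≤ (2 * Real.pi * (ν - 1) * σ ^ 2) ^ (-((n : ℝ) / 2))
      * (Real.Gamma ((n : ℝ) / 2 + ν) / Real.Gamma ν) := by
  have h1 : 0 < ν - 1 := by linarith
  have hA : 0 < (n : ℝ) / 2 + ν := by positivity
  have hq : 0 ≤ ∑ l, z l ^ 2 := Finset.sum_nonneg fun _ _ => sq_nonneg _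
  have h3 := Real.Gamma_pos_of_pos hA
  have h4 := Real.Gamma_pos_of_pos (show 0 < ν by linarith)
  unfold emtdDensity
  refine mul_le_of_le_one_right (by positivity) ?_
  refine Real.rpow_le_one_of_one_le_of_nonpos ?_ (by linarith)
  have : 0 ≤ (∑ l, z l ^ 2) / (2 * (ν - 1) * σ ^ 2) := by positivity
  linarith

theorem measurable_emtdDensity_sub (m : Fin n → ℝ) :
    Measurable fun p : (Fin n → ℝ) × EuclideanSpace ℝ (Fin n) =>
      emtdDensity ν σ fun l => p.1 l - m l - p.2 l :=
  measurable_emtdDensity.comp (by fun_prop)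

theorem integrable_emtdDensity_sub (hν : 1 < ν) (hσ : 0 < σ) (m y : Fin n → ℝ)
    (Q : Measure (EuclideanSpace ℝ (Fin n))) [IsFiniteMeasure Q] :
    Integrable (fun t : EuclideanSpace ℝ (Fin n) => emtdDensity ν σ fun l => y l - m l - t l) Q :=
  Integrable.of_bound ((measurable_emtdDensity_sub m).comp
    measurable_prodMk_left).aestronglyMeasurable _ (ae_of_all _ fun t => by
      rw [Real.norm_eq_abs, abs_of_nonneg (emtdDensity_pos hν hσ _).le]
      exact emtdDensity_le hν hσ _)

variable {X : Type*}

theorem measurable_predDensity (k : X → X → ℝ) (m : Fin n → ℝ) (u : Fin n → X) :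
    Measurable (predDensity ν σ k m u) :=
  ((measurable_emtdDensity_sub m).stronglyMeasurable.integral_prod_right).measurable

theorem lintegral_predDensity (hν : 1 < ν) (hσ : 0 < σ) (k : X → X → ℝ) (m : Fin n → ℝ)
    (u : Fin n → X) : ∫⁻ y, ENNReal.ofReal (predDensity ν σ k m u y) = 1 := by
  have h1 : ∀ y, ENNReal.ofReal (predDensity ν σ k m u y)
      = ∫⁻ t : EuclideanSpace ℝ (Fin n), ENNReal.ofReal (emtdDensity ν σ fun l => y l - m l - t l)
        ∂(multivariateGaussian 0 (gram k u)) := fun y =>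
    ofReal_integral_eq_lintegral_ofReal (integrable_emtdDensity_sub hν hσ m y _)
      (ae_of_all _ fun t => (emtdDensity_pos hν hσ _).le)
  simp_rw [h1]
  rw [lintegral_lintegral_swap (measurable_emtdDensity_sub m).ennreal_ofReal.aemeasurable]
  have h2 : ∀ t : EuclideanSpace ℝ (Fin n),
      ∫⁻ y : Fin n → ℝ, ENNReal.ofReal (emtdDensity ν σ fun l => y l - m l - t l) = 1 := by
    intro t
    rw [← lintegral_emtdDensity (n := n) hν hσ, ← lintegral_sub_right_eq_self
      (fun z : Fin n → ℝ => ENNReal.ofReal (emtdDensity ν σ z)) (fun l => m l + t l)]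
    refine lintegral_congr fun y => ?_
    congr 2
    ext l
    simp only [Pi.sub_apply]
    ring
  simp_rw [h2]
  simp

theorem measurable_condDensity (m : Fin n → ℝ) (τ : X → ℝ) (u : Fin n → X) :
    Measurable (condDensity ν σ m τ u) :=
  measurable_emtdDensity.comp (by fun_prop)

theorem condDensity_eq_sub (m : Fin n → ℝ) (τ : X → ℝ) (u : Fin n → X) (y : Fin n → ℝ) :
    condDensity ν σ m τ u y = emtdDensity ν σ (y - fun l => m l + τ (u l)) := by
  unfold condDensity
  congr 1
  ext l
  simp only [Pi.sub_apply]
  ring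

theorem lintegral_condDensity (hν : 1 < ν) (hσ : 0 < σ) (m : Fin n → ℝ) (τ : X → ℝ)
    (u : Fin n → X) : ∫⁻ y, ENNReal.ofReal (condDensity ν σ m τ u y) = 1 := by
  simp_rw [condDensity_eq_sub]
  rw [lintegral_sub_right_eq_self (fun z : Fin n → ℝ => ENNReal.ofReal (emtdDensity ν σ z)),
    lintegral_emtdDensity hν hσ]

open Matrix in
/-- The Cauchy-Schwarz inequality of a positive semidefinite kernel. -/
theorem sq_sum_mul_kernelSum_le {k : X → X → ℝ} (hk : (Matrix.of k).PosSemidef)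
    {ι J : Type*} [Fintype ι] [Fintype J] (u : ι → X) (v : ι → ℝ) (x : J → X) (a : J → ℝ) :
    (∑ l, v l * ∑ j, a j * k (u l) (x j)) ^ 2
      ≤ (∑ l, v l * ∑ l', k (u l) (u l') * v l') * ∑ i, ∑ j, a i * a j * k (x i) (x j) := by
  have hsymm : ∀ x y, k x y = k y x := fun x y => by
    have := hk.1.apply y x
    simpa using this
  have hM : ((Matrix.of k).submatrix (Sum.elim u x) (Sum.elim u x)).PosSemidef := hk.submatrix _
  -- The quadratic form of the kernel on the points `u` and `x` jointly, at the vector (v, s a), is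
  -- nonnegative for every `s`; its discriminant in `s` is therefore at most zero.
  have hpos : ∀ s : ℝ, 0 ≤ (∑ i, ∑ j, a i * a j * k (x i) (x j)) * (s * s)
      + (2 * ∑ l, v l * ∑ j, a j * k (u l) (x j)) * s
      + ∑ l, v l * ∑ l', k (u l) (u l') * v l' := by
    intro s
    have h := hM.dotProduct_mulVec_nonneg (Sum.elim v (s • a))
    simp only [dotProduct, mulVec, Fintype.sum_sum_type, Matrix.submatrix_apply, Matrix.of_apply,
      Sum.elim_inl, Sum.elim_inr, Pi.star_apply, star_trivial, Pi.smul_apply, smul_eq_mul] at h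
    refine h.trans (le_of_eq ?_)
    have e1 : ∑ j, s * a j * (∑ l, k (x j) (u l) * v l)
        = s * ∑ l, v l * ∑ j, a j * k (u l) (x j) := by
      simp_rw [Finset.mul_sum]
      rw [Finset.sum_comm]
      refine Finset.sum_congr rfl fun l _ => Finset.sum_congr rfl fun j _ => ?_
      rw [hsymm (x j)]; ring
    have e2 : ∑ l, v l * (∑ j, k (u l) (x j) * (s * a j))
        = s * ∑ l, v l * ∑ j, a j * k (u l) (x j) := by
      simp_rw [Finset.mul_sum]
      refine Finset.sum_congr rfl fun l _ => Finset.sum_congr rfl fun j _ => ?_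
      ring
    have e3 : ∑ i, s * a i * (∑ j, k (x i) (x j) * (s * a j))
        = (∑ i, ∑ j, a i * a j * k (x i) (x j)) * (s * s) := by
      simp_rw [Finset.sum_mul, Finset.mul_sum]
      refine Finset.sum_congr rfl fun l _ => Finset.sum_congr rfl fun j _ => ?_
      ring
    simp_rw [mul_add, Finset.sum_add_distrib]
    rw [e1, e2, e3]
    ring
  have := discrim_le_zero hpos
  unfold discrim at this
  nlinarith

theorem kernelSum_self_nonneg {k : X → X → ℝ} (hk : (Matrix.of k).PosSemidef)
    {J : Type*} [Fintype J] (x : J → X) (a : J → ℝ) :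
    0 ≤ ∑ i, ∑ j, a i * a j * k (x i) (x j) := by
  have h := (hk.submatrix x).dotProduct_mulVec_nonneg a
  simp only [dotProduct, Matrix.mulVec, Matrix.submatrix_apply, Matrix.of_apply, Pi.star_apply,
    star_trivial, Finset.mul_sum] at h
  refine h.trans (le_of_eq ?_)
  refine Finset.sum_congr rfl fun l _ => Finset.sum_congr rfl fun j _ => ?_
  ring

open RealInnerProductSpace in
/-- The divergence between the true density and the Bayesian predictive density, bounded in terms
of an approximation of the true random effect by a combination of kernel functions. -/
theorem klDensity_condDensity_predDensity_le (hν : 1 < ν) (hσ : 0 < σ) {k : X → X → ℝ}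
    (hk : (Matrix.of k).PosSemidef) (m : Fin n → ℝ) (τ : X → ℝ) (u : Fin n → X)
    {J : Type*} [Fintype J] (x : J → X) (a : J → ℝ) :
    klDensity (condDensity ν σ m τ u) (predDensity ν σ k m u)
      ≤ ENNReal.ofReal (ν / (2 * (ν - 1) * σ ^ 2)
            * (∑ l, (τ (u l) - ∑ j, a j * k (u l) (x j)) ^ 2)
          + (ν / (2 * (ν - 1)) + 1 / 2) * Real.log (1 + (σ ^ 2)⁻¹ • gram k u).det
          + (∑ i, ∑ j, a i * a j * k (x i) (x j)) / 2) := by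
  have hν1 : 0 < ν - 1 := by linarith
  set L := Real.log (1 + (σ ^ 2)⁻¹ • gram k u).det with hL
  set F := ∑ i, ∑ j, a i * a j * k (x i) (x j) with hF
  set d : Fin n → ℝ := fun l => τ (u l) - ∑ j, a j * k (u l) (x j) with hd
  set D := ∑ l, d l ^ 2 with hD
  have hF0 : 0 ≤ F := kernelSum_self_nonneg hk x a
  have hK : (gram k u).PosSemidef := hk.submatrix u
  set s : Fin n → ℝ := fun l => m l + τ (u l) with hs
  -- Bound on the log-ratio at the error z: here 2 z·d + D = ‖z + d‖² - ‖z‖² is the excess caused by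
  -- replacing τ with its approximation.
  let G : (Fin n → ℝ) → ℝ := fun z =>
    emtdWeight ν σ z * (2 * ∑ l, z l * d l + D + L / (σ ^ 2)⁻¹) + F / 2 + L / 2
  have hb : ∀ v : EuclideanSpace ℝ (Fin n),
      ⟪v, WithLp.toLp 2 fun l => ∑ j, a j * k (u l) (x j)⟫ ^ 2
        ≤ (dotProduct v.ofLp ((gram k u).mulVec v.ofLp)) * F := by
    intro v
    refine le_trans (le_of_eq ?_) (sq_sum_mul_kernelSum_le hk u v.ofLp x a)
    congr 1
    rw [PiLp.inner_apply]
    refine Finset.sum_congr rfl fun l _ => ?_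
    simp [mul_comm]
  have hle : ∀ y, condDensity ν σ m τ u y ≤ predDensity ν σ k m u y * Real.exp (G (y - s)) := by
    intro y
    set z : Fin n → ℝ := y - s with hz
    set w := emtdWeight ν σ z with hw
    have hw0 : 0 ≤ w := emtdWeight_nonneg hν hσ z
    set Y : EuclideanSpace ℝ (Fin n) := WithLp.toLp 2 fun l => y l - m l with hY
    have h1 := exp_le_integral_exp_multivariateGaussian hK hw0
      (show (0 : ℝ) < (σ ^ 2)⁻¹ by positivity) Y _ hF0 hb
    rw [← hL] at h1
    have h2 : emtdDensity ν σ z * Real.exp (w * ∑ l, z l ^ 2)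
          * ∫ t, Real.exp (-(w * ‖Y - t‖ ^ 2)) ∂multivariateGaussian 0 (gram k u)
        ≤ predDensity ν σ k m u y := by
      rw [← integral_const_mul]
      refine integral_mono_of_nonneg (ae_of_all _ fun t => ?_)
        (integrable_emtdDensity_sub hν hσ m y _) (ae_of_all _ fun t => ?_)
      · have := (emtdDensity_pos hν hσ z).le
        simp only [Pi.zero_apply]
        positivity
      · refine le_trans (le_of_eq ?_) (emtdDensity_mul_exp_le hν hσ z _)
        simp only
        rw [mul_assoc, ← Real.exp_add, EuclideanSpace.real_norm_sq_eq]
        congr 2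
        simp only [hY, PiLp.sub_apply]
        ring
    have h3 : ‖Y - WithLp.toLp 2 fun l => ∑ j, a j * k (u l) (x j)‖ ^ 2
        = ∑ l, z l ^ 2 + 2 * ∑ l, z l * d l + D := by
      rw [EuclideanSpace.real_norm_sq_eq, Finset.mul_sum, hD, ← Finset.sum_add_distrib,
        ← Finset.sum_add_distrib]
      refine Finset.sum_congr rfl fun l _ => ?_
      simp only [hY, PiLp.sub_apply, hz, hs, hd, Pi.sub_apply]
      ring
    have h4 : emtdDensity ν σ z * Real.exp (-G z) ≤ predDensity ν σ k m u y := by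
      refine le_trans ?_ h2
      rw [mul_assoc]
      refine mul_le_mul_of_nonneg_left ?_ (emtdDensity_pos hν hσ z).le
      refine le_trans (le_of_eq ?_) (mul_le_mul_of_nonneg_left h1 (Real.exp_pos _).le)
      rw [← Real.exp_add, h3]
      congr 1
      simp only [G, ← hw]
      ring
    rw [condDensity_eq_sub, ← hs, ← hz]
    calc emtdDensity ν σ z = emtdDensity ν σ z * Real.exp (-G z) * Real.exp (G z) := by
          rw [mul_assoc, ← Real.exp_add]; simp
      _ ≤ _ := mul_le_mul_of_nonneg_right h4 (Real.exp_pos _).le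
  have hcpos : ∀ y, 0 < condDensity ν σ m τ u y := fun y => emtdDensity_pos hν hσ _
  -- Positivity of the mixture comes for free from the lower bound just proved.
  have hppos : ∀ y, 0 < predDensity ν σ k m u y := fun y =>
    pos_of_mul_pos_left ((hcpos y).trans_le (hle y)) (Real.exp_pos _).le
  have hsplit : (fun z => emtdDensity ν σ z * G z) = fun z =>
      (2 * (emtdDensity ν σ z * emtdWeight ν σ z * ∑ l, z l * d l)
        + (D + L / (σ ^ 2)⁻¹) * (emtdDensity ν σ z * emtdWeight ν σ z))
        + (F / 2 + L / 2) * emtdDensity ν σ z := by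
    ext z; simp only [G]; ring
  have i1 : Integrable fun z => 2 * (emtdDensity ν σ z * emtdWeight ν σ z * ∑ l, z l * d l) :=
    (integrable_emtdDensity_mul_emtdWeight_mul hν hσ d).const_mul 2
  have i2 : Integrable fun z : Fin n → ℝ =>
      (D + L / (σ ^ 2)⁻¹) * (emtdDensity ν σ z * emtdWeight ν σ z) :=
    (integrable_emtdDensity_mul_emtdWeight hν hσ).const_mul _
  have i3 : Integrable fun z : Fin n → ℝ => (F / 2 + L / 2) * emtdDensity ν σ z :=
    (integrable_emtdDensity hν hσ).const_mul _
  have i12 : Integrable fun z => 2 * (emtdDensity ν σ z * emtdWeight ν σ z * ∑ l, z l * d l)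
      + (D + L / (σ ^ 2)⁻¹) * (emtdDensity ν σ z * emtdWeight ν σ z) := i1.add i2
  have hint : Integrable fun z => emtdDensity ν σ z * G z := by
    rw [hsplit]; exact i12.add i3
  have hshift : (fun y => condDensity ν σ m τ u y * G (y - s))
      = fun y => (fun z => emtdDensity ν σ z * G z) (y - s) := by
    ext y; rw [condDensity_eq_sub]
  have hval : ∫ z, emtdDensity ν σ z * G z
      = (D + L / (σ ^ 2)⁻¹) * (ν / (2 * (ν - 1) * σ ^ 2)) + (F / 2 + L / 2) := by
    rw [hsplit, integral_add i12 i3, integral_add i1 i2, integral_const_mul, integral_const_mul,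
      integral_const_mul, integral_emtdDensity_mul_emtdWeight_mul,
      integral_emtdDensity_mul_emtdWeight hν hσ, integral_emtdDensity hν hσ]
    ring
  refine (klDensity_le_of_le_mul_exp (measurable_condDensity m τ u)
    (measurable_predDensity k m u) hcpos hppos (lintegral_condDensity hν hσ m τ u)
    (lintegral_predDensity hν hσ k m u) hle ?_).trans (le_of_eq ?_)
  · rw [hshift]; exact hint.comp_sub_right s
  · rw [hshift, integral_sub_right_eq_self (fun z => emtdDensity ν σ z * G z) s, hval]
    congr 1
    field_simp
    ring

end pred

/-! ### Fischer's inequality and subadditivity of the log-determinant -/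

-- This is log x ≤ x - 1 summed over eigenvalues. The product `M * N` need not be symmetric, so with
-- N = CᵀC one uses C M Cᵀ, which has the same determinant and trace.
open scoped MatrixOrder in
theorem log_det_add_log_det_le {n : Type*} [Fintype n] [DecidableEq n] {M N : Matrix n n ℝ}
    (hM : M.PosDef) (hN : N.PosDef) :
    Real.log M.det + Real.log N.det ≤ (M * N).trace - Fintype.card n := by
  obtain ⟨C, hC⟩ : ∃ C : Matrix n n ℝ, N = C.conjTranspose * C :=
    ⟨CFC.sqrt N, by
      rw [(Matrix.nonneg_iff_posSemidef.1 (CFC.sqrt_nonneg N)).1,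
        CFC.sqrt_mul_sqrt_self _ hN.posSemidef.nonneg]⟩
  have hP : (C * M * C.conjTranspose).PosSemidef := hM.posSemidef.mul_mul_conjTranspose_same C
  have hdet : (C * M * C.conjTranspose).det = M.det * N.det := by
    rw [hC]; simp only [Matrix.det_mul]; ring
  have htr : (C * M * C.conjTranspose).trace = (M * N).trace := by
    rw [hC, Matrix.mul_assoc, Matrix.trace_mul_comm, Matrix.mul_assoc]
  have hne : (C * M * C.conjTranspose).det ≠ 0 := by
    rw [hdet]; exact (mul_pos hM.det_pos hN.det_pos).ne'
  rw [← Real.log_mul hM.det_pos.ne' hN.det_pos.ne', ← hdet, ← htr, hP.1.trace_eq_sum_eigenvalues,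
    hP.1.det_eq_prod_eigenvalues]
  rw [hP.1.det_eq_prod_eigenvalues] at hne
  simp only [RCLike.ofReal_real_eq_id, id] at hne ⊢
  have hne' := Finset.prod_ne_zero_iff.1 hne
  rw [Real.log_prod hne', ← Finset.card_univ, Finset.cast_card, ← Finset.sum_sub_distrib]
  exact Finset.sum_le_sum fun i hi => Real.log_le_sub_one_of_pos
    ((hP.eigenvalues_nonneg i).lt_of_ne (hne' i hi).symm)

/-- **Fischer's inequality** for the logarithm of the determinant. -/
theorem log_det_fromBlocks_le {m n : Type*} [Fintype m] [Fintype n] [DecidableEq m]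
    [DecidableEq n] {A : Matrix m m ℝ} {B : Matrix m n ℝ} {C : Matrix n m ℝ} {D : Matrix n n ℝ}
    (hM : (Matrix.fromBlocks A B C D).PosDef) :
    Real.log (Matrix.fromBlocks A B C D).det ≤ Real.log A.det + Real.log D.det := by
  have hA : A.PosDef := by
    have := hM.submatrix (e := Sum.inl) Sum.inl_injective
    exact this
  have hD : D.PosDef := by
    have := hM.submatrix (e := Sum.inr) Sum.inr_injective
    exact this
  -- With N the inverse of the block-diagonal part, the trace of the product equals the full
  -- dimension, and the right side of `log_det_add_log_det_le` is zero.
  have hN : (Matrix.fromBlocks A⁻¹ 0 0 D⁻¹).PosDef := by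
    refine Matrix.PosDef.of_dotProduct_mulVec_pos ?_ fun x hx => ?_
    · rw [Matrix.isHermitian_fromBlocks_iff]
      exact ⟨hA.inv.1, by simp, by simp, hD.inv.1⟩
    · have h1 : star x ⬝ᵥ (Matrix.fromBlocks A⁻¹ 0 0 D⁻¹).mulVec x
          = star (x ∘ Sum.inl) ⬝ᵥ A⁻¹.mulVec (x ∘ Sum.inl)
            + star (x ∘ Sum.inr) ⬝ᵥ D⁻¹.mulVec (x ∘ Sum.inr) := by
        rw [Matrix.fromBlocks_mulVec]
        simp [dotProduct, Fintype.sum_sum_type]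
      rw [h1]
      by_cases hl : x ∘ Sum.inl = 0
      · have hr : x ∘ Sum.inr ≠ 0 := by
          intro hr
          apply hx
          ext i
          rcases i with i | i
          · exact congrFun hl i
          · exact congrFun hr i
        exact add_pos_of_nonneg_of_pos (hA.inv.posSemidef.dotProduct_mulVec_nonneg _)
          (hD.inv.dotProduct_mulVec_pos hr)
      · exact add_pos_of_pos_of_nonneg (hA.inv.dotProduct_mulVec_pos hl)
          (hD.inv.posSemidef.dotProduct_mulVec_nonneg _)
  have h := log_det_add_log_det_le hM hN
  have hA1 : A * A⁻¹ = 1 := Matrix.mul_nonsing_inv _ (isUnit_iff_ne_zero.2 hA.det_pos.ne')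
  have hD1 : D * D⁻¹ = 1 := Matrix.mul_nonsing_inv _ (isUnit_iff_ne_zero.2 hD.det_pos.ne')
  rw [Matrix.fromBlocks_multiply, Matrix.trace, Fintype.sum_sum_type, Matrix.det_fromBlocks_zero₂₁] at h
  simp only [Matrix.diag_apply, Matrix.fromBlocks_apply₁₁, Matrix.fromBlocks_apply₂₂,
    Matrix.mul_zero, add_zero, zero_add, hA1, hD1, Matrix.one_apply_eq, Finset.sum_const,
    Finset.card_univ, nsmul_eq_mul, mul_one,
    Fintype.card_sum, Nat.cast_add, sub_self] at h
  rw [Matrix.det_nonsing_inv, Matrix.det_nonsing_inv, Ring.inverse_eq_inv', Real.log_mul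
    (inv_ne_zero hA.det_pos.ne') (inv_ne_zero hD.det_pos.ne'), Real.log_inv, Real.log_inv] at h
  linarith

variable {X : Type*}

theorem posDef_one_add_smul_gram {k : X → X → ℝ} (hk : (Matrix.of k).PosSemidef) {r : ℝ}
    (hr : 0 ≤ r) {n : ℕ} (u : Fin n → X) : (1 + r • gram k u).PosDef :=
  Matrix.PosDef.one.add_posSemidef (Matrix.PosSemidef.smul (hk.submatrix u) hr)

/-- Splitting the sample splits the matrix into blocks whose diagonal ones belong to the two
subsamples. This holds for each kernel separately, hence survives a supremum over parameters. -/
theorem log_det_gram_add_le {k : X → X → ℝ} (hk : (Matrix.of k).PosSemidef) {r : ℝ}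
    (hr : 0 ≤ r) {a b : ℕ} (u : Fin (a + b) → X) :
    Real.log (1 + r • gram k u).det
      ≤ Real.log (1 + r • gram k (u ∘ Fin.castAdd b)).det
        + Real.log (1 + r • gram k (u ∘ Fin.natAdd a)).det := by
  have hM := posDef_one_add_smul_gram hk hr u
  have hM' := hM.submatrix (e := finSumFinEquiv) finSumFinEquiv.injective
  rw [← Matrix.det_submatrix_equiv_self finSumFinEquiv (1 + r • gram k u)]
  rw [← Matrix.fromBlocks_toBlocks
    ((1 + r • gram k u).submatrix finSumFinEquiv finSumFinEquiv)] at hM' ⊢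
  refine (log_det_fromBlocks_le hM').trans (le_of_eq ?_)
  congr 3
  · ext i j
    simp [Matrix.toBlocks₁₁, gram, Matrix.one_apply]
  · ext i j
    simp [Matrix.toBlocks₂₂, gram, Matrix.one_apply]

theorem log_det_gram_nonneg {k : X → X → ℝ} (hk : (Matrix.of k).PosSemidef) {r : ℝ}
    (hr : 0 ≤ r) {n : ℕ} (u : Fin n → X) : 0 ≤ Real.log (1 + r • gram k u).det :=
  log_det_one_add_smul_nonneg (hk.submatrix u) hr

theorem log_det_gram_le {k : X → X → ℝ} (hk : (Matrix.of k).PosSemidef) {r : ℝ}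
    (hr : 0 ≤ r) {κ : ℝ} (hκ : ∀ x, k x x ≤ κ) {n : ℕ} (u : Fin n → X) :
    Real.log (1 + r • gram k u).det ≤ n * (r * κ) := by
  refine (log_det_one_add_smul_le_trace (K := gram k u) (hk.submatrix u) hr).trans ?_
  have : (gram k u).trace ≤ n * κ := by
    rw [Matrix.trace]
    refine (Finset.sum_le_card_nsmul _ _ κ fun i _ => hκ (u i)).trans (by simp)
  nlinarith

/-! ### Approximation in the reproducing kernel Hilbert space -/

/-- A function in the reproducing kernel Hilbert space of a bounded kernel is a uniform limit of
combinations of kernel functions. -/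
theorem RKHSNormLE.exists_sum_kernel {k : X → X → ℝ} {f : X → ℝ} {M : ℝ}
    (hf : RKHSNormLE k f M) {κ : ℝ} (hκ : ∀ x x', |k x x'| ≤ κ) {ε : ℝ} (hε : 0 < ε) :
    ∃ (N : ℕ) (x : Fin N → X) (a : Fin N → ℝ), ∀ z, |f z - ∑ j, a j * k z (x j)| ≤ ε := by
  obtain ⟨hk, hf⟩ := hf
  have : Fact (opKernel k).PosSemidef := ⟨hk⟩
  obtain ⟨h, rfl, -⟩ := hf
  have hcl : h ∈ (Submodule.span ℝ {RKHS.kerFun (RKHS.OfKernel (opKernel k)) x v | (x) (v)}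
      ).topologicalClosure := by
    rw [RKHS.kerFun_dense]; trivial
  -- Evaluation at a point costs at most a factor √κ; the added 1 keeps the divisor positive.
  obtain ⟨g, hg, hgd⟩ := Metric.mem_closure_iff.1 hcl (ε / (√κ + 1)) (by positivity)
  obtain ⟨N, c, w, hw⟩ := Submodule.mem_span_set'.1 hg
  choose x v hxv using fun j => (w j).2
  refine ⟨N, x, fun j => c j * v j, fun z => ?_⟩
  have hkz : ∀ y, ‖opKernel k y y‖ ≤ κ := by
    intro y
    refine ContinuousLinearMap.opNorm_le_bound _ ((abs_nonneg _).trans (hκ y y)) fun t => ?_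
    simp only [opKernel, Matrix.of_apply, smul_apply,
      ContinuousLinearMap.id_apply, norm_smul, Real.norm_eq_abs]
    exact mul_le_mul_of_nonneg_right (hκ y y) (abs_nonneg _)
  have hgz : g z = ∑ j, c j * v j * k z (x j) := by
    rw [← hw, ← RKHS.coeCLM_apply, map_sum, Finset.sum_apply]
    refine Finset.sum_congr rfl fun j _ => ?_
    rw [map_smul, ← hxv j, RKHS.coeCLM_apply, Pi.smul_apply, RKHS.kerFun_apply,
      RKHS.OfKernel.kernel_ofKernel]
    simp [opKernel]
    ring
  rw [← hgz, ← Pi.sub_apply, ← RKHS.coe_sub, ← Real.norm_eq_abs]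
  refine (RKHS.norm_apply_le (h - g) z).trans ?_
  rw [RKHS.OfKernel.kernel_ofKernel]
  rw [dist_eq_norm] at hgd
  calc ‖h - g‖ * √‖opKernel k z z‖ ≤ ε / (√κ + 1) * (√κ + 1) := by
        refine mul_le_mul hgd.le ?_ (Real.sqrt_nonneg _) (by positivity)
        exact (Real.sqrt_le_sqrt (hkz z)).trans (by linarith)
    _ = ε := by field_simp

/-- Inherited from kernel combinations through uniform limits. Measurability of the true random
effect is thus a consequence of condition (A), and it is what makes the law of the data a
probability measure. -/
theorem RKHSNormLE.measurable [MeasurableSpace X] {k : X → X → ℝ} {f : X → ℝ} {M : ℝ}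
    (hf : RKHSNormLE k f M) {κ : ℝ} (hκ : ∀ x x', |k x x'| ≤ κ)
    (hk : Measurable fun z : X × X => k z.1 z.2) : Measurable f := by
  choose N x a h using fun m : ℕ => hf.exists_sum_kernel hκ (Nat.one_div_pos_of_nat (n := m) (α := ℝ))
  refine measurable_of_tendsto_metrizable
    (f := fun m z => ∑ j, a m j * k z (x m j)) (fun m => ?_) ?_
  · refine Finset.measurable_sum _ fun j _ => Measurable.const_mul ?_ _
    exact hk.comp measurable_prodMk_right
  · refine tendsto_pi_nhds.2 fun z => ?_
    rw [tendsto_iff_dist_tendsto_zero]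
    refine squeeze_zero (fun _ => dist_nonneg) (fun m => ?_) tendsto_one_div_add_atTop_nhds_zero_nat
    rw [dist_comm, Real.dist_eq]
    exact h m z

theorem RKHSNormLE.exists_abs_le {k : X → X → ℝ} {f : X → ℝ} {M : ℝ}
    (hf : RKHSNormLE k f M) {κ : ℝ} (hκ : ∀ x x', |k x x'| ≤ κ) : ∃ T, ∀ z, |f z| ≤ T := by
  obtain ⟨N, x, a, h⟩ := hf.exists_sum_kernel hκ one_pos
  refine ⟨1 + ∑ j, |a j| * κ, fun z => ?_⟩
  have h1 : |∑ j, a j * k z (x j)| ≤ ∑ j, |a j| * κ :=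
    (Finset.abs_sum_le_sum_abs _ _).trans (Finset.sum_le_sum fun j _ => by
      rw [abs_mul]; exact mul_le_mul_of_nonneg_left (hκ _ _) (abs_nonneg _))
  have h2 := abs_sub_abs_le_abs_sub (f z) (∑ j, a j * k z (x j))
  linarith [h z]

/-! ### Suprema over balls of parameters -/

section envelope

variable {Θ Ω : Type*} [PseudoMetricSpace Θ]

/-- The supremum over the parameters at distance less than `δ` from `θ₀`. -/
noncomputable def envelope (F : Θ → Ω → ℝ) (θ₀ : Θ) (δ : ℝ) (ω : Ω) : ℝ≥0∞ :=
  ⨆ θ ∈ Metric.ball θ₀ δ, ENNReal.ofReal (F θ ω)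

theorem le_envelope {F : Θ → Ω → ℝ} {θ₀ θ : Θ} {δ : ℝ} (hθ : dist θ θ₀ < δ) (ω : Ω) :
    ENNReal.ofReal (F θ ω) ≤ envelope F θ₀ δ ω :=
  le_iSup₂ (f := fun θ (_ : θ ∈ Metric.ball θ₀ δ) => ENNReal.ofReal (F θ ω)) θ hθ

theorem envelope_le {F : Θ → Ω → ℝ} {θ₀ : Θ} {δ : ℝ} {ω : Ω} {b : ℝ≥0∞}
    (h : ∀ θ, dist θ θ₀ < δ → ENNReal.ofReal (F θ ω) ≤ b) : envelope F θ₀ δ ω ≤ b :=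
  iSup₂_le h

/-- Continuity in the parameter reduces the supremum over the open ball to one over a countable
dense subset. -/
theorem measurable_envelope [TopologicalSpace.SeparableSpace Θ] [MeasurableSpace Ω]
    {F : Θ → Ω → ℝ} (hm : ∀ θ, Measurable (F θ)) (hc : ∀ ω, Continuous fun θ => F θ ω) (θ₀ : Θ)
    (δ : ℝ) : Measurable (envelope F θ₀ δ) := by
  obtain ⟨D, hD, hdense⟩ := TopologicalSpace.exists_countable_dense Θ
  have h : envelope F θ₀ δ = fun ω => ⨆ θ ∈ Metric.ball θ₀ δ ∩ D, ENNReal.ofReal (F θ ω) := by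
    ext ω
    refine le_antisymm (iSup₂_le fun θ hθ => ?_) (biSup_mono Set.inter_subset_left)
    have hcl : IsClosed {θ | ENNReal.ofReal (F θ ω)
        ≤ ⨆ θ ∈ Metric.ball θ₀ δ ∩ D, ENNReal.ofReal (F θ ω)} :=
      isClosed_le (ENNReal.continuous_ofReal.comp (hc ω)) continuous_const
    exact hcl.closure_subset_iff.2 (fun θ' hθ' => le_iSup₂ (f := fun θ
      (_ : θ ∈ Metric.ball θ₀ δ ∩ D) => ENNReal.ofReal (F θ ω)) θ' hθ')
      (hdense.open_subset_closure_inter Metric.isOpen_ball hθ)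
  rw [h]
  exact Measurable.biSup _ (hD.mono Set.inter_subset_right) fun θ _ => (hm θ).ennreal_ofReal

theorem tendsto_envelope {F : Θ → Ω → ℝ} {θ₀ : Θ} {ω : Ω} (hc : ContinuousAt (fun θ => F θ ω) θ₀) :
    Tendsto (fun m : ℕ => envelope F θ₀ (1 / ((m : ℝ) + 1)) ω) atTop
      (𝓝 (ENNReal.ofReal (F θ₀ ω))) := by
  refine tendsto_order.2 ⟨fun b hb => Eventually.of_forall fun m => hb.trans_le
    (le_envelope (by rw [dist_self]; exact Nat.one_div_pos_of_nat) ω), fun b hb => ?_⟩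
  obtain ⟨b', hb1, hb2⟩ := exists_between hb
  have h1 : ∀ᶠ θ in 𝓝 θ₀, ENNReal.ofReal (F θ ω) < b' :=
    (ENNReal.continuous_ofReal.continuousAt.comp hc).eventually_lt_const hb1
  obtain ⟨δ, hδ, hδb⟩ := Metric.eventually_nhds_iff.1 h1
  have h2 : ∀ᶠ m : ℕ in atTop, 1 / ((m : ℝ) + 1) < δ :=
    tendsto_one_div_add_atTop_nhds_zero_nat.eventually_lt_const hδ
  filter_upwards [h2] with m hm
  exact (envelope_le fun θ hθ => (hδb (hθ.trans hm)).le).trans_lt hb2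

/-- Dominated convergence by the constant bound. It turns smallness in mean at `θ₀` into smallness
in mean uniformly over some ball. -/
theorem tendsto_lintegral_envelope [TopologicalSpace.SeparableSpace Θ] [MeasurableSpace Ω]
    {F : Θ → Ω → ℝ} (hm : ∀ θ, Measurable (F θ)) (hc : ∀ ω, Continuous fun θ => F θ ω) {B : ℝ}
    (hB : ∀ θ ω, F θ ω ≤ B) (θ₀ : Θ) (Q : Measure Ω) [IsFiniteMeasure Q] :
    Tendsto (fun m : ℕ => ∫⁻ ω, envelope F θ₀ (1 / ((m : ℝ) + 1)) ω ∂Q) atTop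
      (𝓝 (∫⁻ ω, ENNReal.ofReal (F θ₀ ω) ∂Q)) :=
  tendsto_lintegral_of_dominated_convergence (fun _ => ENNReal.ofReal B)
    (fun _ => measurable_envelope hm hc θ₀ _)
    (fun _ => ae_of_all _ fun ω => envelope_le fun θ _ => ENNReal.ofReal_le_ofReal (hB θ ω))
    (by simpa using ENNReal.mul_ne_top ENNReal.ofReal_ne_top (measure_ne_top Q _))
    (ae_of_all _ fun ω => tendsto_envelope (hc ω).continuousAt)

end envelope

/-! ### Subsamples and subadditive sequences -/

/-- A subsample of an independent, identically distributed sample has the same kind of law. Applied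
to the first `a` and the last `b` of `a + b` covariates. -/
theorem map_pi_comp_injective {ι ι' X : Type*} [Fintype ι] [Fintype ι'] [MeasurableSpace X]
    (P : Measure X) [IsProbabilityMeasure P] {f : ι → ι'} (hf : f.Injective) :
    (Measure.pi fun _ : ι' => P).map (fun u => u ∘ f) = Measure.pi fun _ : ι => P := by
  have h1 : iIndepFun (fun (i : ι') (u : ι' → X) => u i) (Measure.pi fun _ : ι' => P) :=
    iIndepFun_pi (X := fun _ => id) fun _ => aemeasurable_id
  have h2 := (iIndepFun_iff_map_fun_eq_pi_map
    (fun i => (measurable_pi_apply (f i)).aemeasurable)).1 (h1.precomp hf)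
  have h3 : ∀ i : ι, (Measure.pi fun _ : ι' => P).map (fun u => u (f i)) = P := fun i =>
    (measurePreserving_eval (fun _ : ι' => P) (f i)).map_eq
  simp only [h3] at h2
  exact h2

/-- A subadditive sequence that is small on average at one index is small on average eventually. -/
theorem eventually_le_mul_of_subadditive {e : ℕ → ℝ≥0∞} (hadd : ∀ a b, e (a + b) ≤ e a + e b)
    {C : ℝ} (hC : ∀ n : ℕ, e n ≤ ENNReal.ofReal (n * C)) {ε : ℝ} (hε : 0 < ε) {N : ℕ} (hN : 0 < N)
    (h : e N ≤ ENNReal.ofReal (N * (ε / 2))) :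
    ∀ᶠ n : ℕ in atTop, e n ≤ ENNReal.ofReal (n * ε) := by
  have hmul : ∀ q r : ℕ, e (q * N + r) ≤ q * e N + e r := by
    intro q r
    induction q with
    | zero => simp
    | succ q ih =>
      calc e ((q + 1) * N + r) = e (N + (q * N + r)) := by congr 1; ring
        _ ≤ e N + (q * e N + e r) := (hadd _ _).trans (by gcongr)
        _ = _ := by push_cast; ring
  -- The remainder of n modulo N costs at most N|C|, which the second half of the budget, nε/2,
  -- absorbs for such n.
  have hev : ∀ᶠ n : ℕ in atTop, (N * |C|) / (ε / 2) ≤ (n : ℝ) :=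
    tendsto_natCast_atTop_atTop.eventually_ge_atTop _
  filter_upwards [hev] with n hn
  have hdm : n / N * N + n % N = n := by rw [mul_comm]; exact Nat.div_add_mod n N
  calc e n = e (n / N * N + n % N) := by rw [hdm]
    _ ≤ (n / N : ℕ) * e N + e (n % N) := hmul _ _
    _ ≤ ENNReal.ofReal (n / N : ℕ) * ENNReal.ofReal (N * (ε / 2))
        + ENNReal.ofReal ((n % N : ℕ) * C) := by
      rw [ENNReal.ofReal_natCast]
      gcongr
      exact hC _
    _ ≤ ENNReal.ofReal ((n / N : ℕ) * (N * (ε / 2))) + ENNReal.ofReal (N * |C|) := by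
      rw [← ENNReal.ofReal_mul (by positivity)]
      have h1 : ((n % N : ℕ) : ℝ) ≤ N := by exact_mod_cast (Nat.mod_lt n hN).le
      have h2 : ((n % N : ℕ) : ℝ) * C ≤ N * |C| :=
        (mul_le_mul_of_nonneg_left (le_abs_self C) (by positivity)).trans
          (mul_le_mul_of_nonneg_right h1 (abs_nonneg C))
      gcongr
    _ = ENNReal.ofReal ((n / N : ℕ) * (N * (ε / 2)) + N * |C|) :=
      (ENNReal.ofReal_add (by positivity) (by positivity)).symm
    _ ≤ ENNReal.ofReal (n * ε) := by
      apply ENNReal.ofReal_le_ofReal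
      rw [div_le_iff₀ (by positivity)] at hn
      have h1 : ((n / N : ℕ) : ℝ) * N ≤ n := by exact_mod_cast Nat.div_mul_le_self n N
      have h2 := mul_le_mul_of_nonneg_right h1 (show 0 ≤ ε / 2 by positivity)
      linarith

/-! ### The law of the data and its covariate marginals -/

section dataLaw

variable {ν σ : ℝ} {X : Type*} [MeasurableSpace X] {n : ℕ}

theorem measurable_condDensity_prod (m : Fin n → ℝ) {τ : X → ℝ} (hτ : Measurable τ) :
    Measurable fun d : (Fin n → X) × (Fin n → ℝ) => condDensity ν σ m τ d.1 d.2 :=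
  measurable_emtdDensity.comp (by fun_prop)

/-- Given the covariates the responses have a density of mass one, so integrating them out leaves
the product law. -/
theorem lintegral_curveLaw_fst (hν : 1 < ν) (hσ : 0 < σ) (P : Measure X)
    [IsProbabilityMeasure P] {τ : X → ℝ} (hτ : Measurable τ) (m : Fin n → ℝ)
    {H : (Fin n → X) → ℝ≥0∞} (hH : Measurable H) :
    ∫⁻ d, H d.1 ∂(curveLaw ν σ P τ m) = ∫⁻ u, H u ∂(Measure.pi fun _ : Fin n => P) := by
  have hd := (measurable_condDensity_prod (ν := ν) (σ := σ) m hτ).ennreal_ofReal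
  have hH' : Measurable fun d : (Fin n → X) × (Fin n → ℝ) => H d.1 := hH.comp measurable_fst
  rw [curveLaw, lintegral_withDensity_eq_lintegral_mul _ hd hH',
    lintegral_prod _ (hd.mul hH').aemeasurable]
  refine lintegral_congr fun u => ?_
  simp only [Pi.mul_apply]
  rw [lintegral_mul_const _ (measurable_condDensity m τ u).ennreal_ofReal,
    lintegral_condDensity hν hσ, one_mul]

theorem isProbabilityMeasure_curveLaw (hν : 1 < ν) (hσ : 0 < σ) (P : Measure X)
    [IsProbabilityMeasure P] {τ : X → ℝ} (hτ : Measurable τ) (m : Fin n → ℝ) :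
    IsProbabilityMeasure (curveLaw ν σ P τ m) :=
  ⟨by
    have h := lintegral_curveLaw_fst hν hσ P hτ m (H := fun _ => 1) measurable_const
    simpa using h⟩

variable {I : ℕ} {J : Fin I → ℕ}

theorem isProbabilityMeasure_dataLaw (hν : 1 < ν) (hσ : 0 < σ) (μ : ℝ → ℝ) (α : Fin I → ℝ → ℝ)
    (P : Curve J → Measure X) [∀ c, IsProbabilityMeasure (P c)] {τ : Curve J → X → ℝ}
    (hτ : ∀ c, Measurable (τ c)) (t : Fin n → ℝ) :
    IsProbabilityMeasure (dataLaw ν σ μ α P τ t) := by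
  have := fun c => isProbabilityMeasure_curveLaw hν hσ (P c) (hτ c) (meanVec μ α c t)
  unfold dataLaw
  infer_instance

theorem lintegral_dataLaw_covariates (hν : 1 < ν) (hσ : 0 < σ) (μ : ℝ → ℝ) (α : Fin I → ℝ → ℝ)
    (P : Curve J → Measure X) [∀ c, IsProbabilityMeasure (P c)] {τ : Curve J → X → ℝ}
    (hτ : ∀ c, Measurable (τ c)) (t : Fin n → ℝ) (c : Curve J)
    {H : (Fin n → X) → ℝ≥0∞} (hH : Measurable H) :
    ∫⁻ d, H (d c).1 ∂(dataLaw ν σ μ α P τ t) = ∫⁻ u, H u ∂(Measure.pi fun _ : Fin n => P c) := by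
  have := fun c => isProbabilityMeasure_curveLaw hν hσ (P c) (hτ c) (meanVec μ α c t)
  rw [← lintegral_curveLaw_fst hν hσ (P c) (hτ c) (meanVec μ α c t) hH]
  exact (measurePreserving_eval
    (fun c => curveLaw ν σ (P c) (τ c) (meanVec μ α c t)) c).lintegral_comp
    (hH.comp measurable_fst)

end dataLaw

/-! ### The expected log-determinant, uniformly near the true parameter -/

section regret

variable {X Θ : Type*} {k : Θ → X → X → ℝ}

/-- The log-determinant of a Gaussian process regression as a function of the kernel parameter. -/
noncomputable def logDetGram (k : Θ → X → X → ℝ) (r : ℝ) {n : ℕ} (θ : Θ) (u : Fin n → X) : ℝ :=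
  Real.log (1 + r • gram (k θ) u).det

theorem measurable_logDetGram [MeasurableSpace X]
    (hk_meas : ∀ θ, Measurable fun z : X × X => k θ z.1 z.2) (r : ℝ) (n : ℕ) (θ : Θ) :
    Measurable (logDetGram k r θ : (Fin n → X) → ℝ) := by
  refine Real.measurable_log.comp ?_
  simp_rw [Matrix.det_apply]
  refine Finset.measurable_sum _ fun s _ => ?_
  refine Measurable.const_smul ?_ _
  refine Finset.measurable_prod _ fun i _ => ?_
  simp only [Matrix.add_apply, Matrix.smul_apply, gram, Matrix.of_apply, smul_eq_mul]
  have h : Measurable fun u : Fin n → X => k θ (u (s i)) (u i) :=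
    Measurable.comp (f := fun u : Fin n → X => (u (s i), u i)) (hk_meas θ)
      ((measurable_pi_apply (s i)).prodMk (measurable_pi_apply i))
  exact (h.const_mul r).const_add _

theorem continuous_logDetGram [TopologicalSpace Θ]
    (hk_psd : ∀ θ, (Matrix.of (k θ)).PosSemidef)
    (hk_cont : ∀ x x', Continuous fun θ => k θ x x') {r : ℝ} (hr : 0 ≤ r) {n : ℕ}
    (u : Fin n → X) : Continuous fun θ => logDetGram k r θ u := by
  refine Continuous.log ?_ fun θ => (posDef_one_add_smul_gram (hk_psd θ) hr u).det_pos.ne'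
  refine Continuous.matrix_det ?_
  refine continuous_const.add (Continuous.const_smul ?_ r)
  exact continuous_matrix fun i j => hk_cont (u i) (u j)

/-- If the expected log-determinant at `θ₀` is of smaller order than the sample size, then so is,
up to `ε`, the expected supremum of the log-determinants over a neighbourhood of `θ₀`. -/
theorem exists_lintegral_envelope_logDetGram_le [PseudoMetricSpace Θ]
    [TopologicalSpace.SeparableSpace Θ] [MeasurableSpace X] (hk_psd : ∀ θ, (Matrix.of (k θ)).PosSemidef)
    (hk_meas : ∀ θ, Measurable fun z : X × X => k θ z.1 z.2) {κ : ℝ}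
    (hκ : ∀ θ x x', |k θ x x'| ≤ κ) (hk_cont : ∀ x x', Continuous fun θ => k θ x x')
    {r : ℝ} (hr : 0 ≤ r) (P : Measure X) [IsProbabilityMeasure P] (θ₀ : Θ)
    (hA : (fun n : ℕ => ∫ u, logDetGram k r θ₀ u ∂(Measure.pi fun _ : Fin n => P))
      =o[atTop] fun n : ℕ => (n : ℝ)) {ε : ℝ} (hε : 0 < ε) :
    ∃ δ > 0, ∀ᶠ n : ℕ in atTop,
      ∫⁻ u, envelope (logDetGram k r) θ₀ δ u ∂(Measure.pi fun _ : Fin n => P)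
        ≤ ENNReal.ofReal (n * ε) := by
  have hm := measurable_logDetGram hk_meas r
  have hc : ∀ {n : ℕ} (u : Fin n → X), Continuous fun θ => logDetGram k r θ u := fun u =>
    continuous_logDetGram hk_psd hk_cont hr u
  have hB : ∀ {n : ℕ} θ (u : Fin n → X), logDetGram k r θ u ≤ n * (r * κ) := fun θ u =>
    log_det_gram_le (hk_psd θ) hr (fun x => (le_abs_self _).trans (hκ θ x x)) u
  have h0 : ∀ {n : ℕ} θ (u : Fin n → X), 0 ≤ logDetGram k r θ u := fun θ u =>
    log_det_gram_nonneg (hk_psd θ) hr u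
  -- A single sample size N is fixed here. The margin between ε/4 and ε/2 leaves room for the
  -- supremum over a ball, whose radius then depends on N but not on n.
  obtain ⟨N, hN, hN1⟩ := ((hA.bound (show 0 < ε / 4 by positivity)).and
    (eventually_gt_atTop 0)).exists
  have hNpos : (0 : ℝ) < N := by exact_mod_cast hN1
  have hint : Integrable (fun u => logDetGram k r θ₀ u) (Measure.pi fun _ : Fin N => P) :=
    Integrable.of_bound (hm N θ₀).aestronglyMeasurable (N * (r * κ)) (ae_of_all _ fun u => by
      rw [Real.norm_eq_abs, abs_of_nonneg (h0 θ₀ u)]; exact hB θ₀ u)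
  have hlt : ∫⁻ u, ENNReal.ofReal (logDetGram k r θ₀ u) ∂(Measure.pi fun _ : Fin N => P)
      < ENNReal.ofReal (N * (ε / 2)) := by
    rw [← ofReal_integral_eq_lintegral_ofReal hint (ae_of_all _ fun u => h0 θ₀ u),
      ENNReal.ofReal_lt_ofReal_iff (by positivity)]
    rw [Real.norm_eq_abs, Real.norm_eq_abs, Nat.abs_cast] at hN
    refine (le_abs_self _).trans_lt (hN.trans_lt ?_)
    nlinarith
  obtain ⟨j, hj⟩ := ((tendsto_lintegral_envelope (hm N) hc hB θ₀
    (Measure.pi fun _ : Fin N => P)).eventually_lt_const hlt).exists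
  refine ⟨1 / ((j : ℝ) + 1), Nat.one_div_pos_of_nat, ?_⟩
  set δ := 1 / ((j : ℝ) + 1)
  refine eventually_le_mul_of_subadditive (e := fun n =>
    ∫⁻ u, envelope (logDetGram k r) θ₀ δ u ∂(Measure.pi fun _ : Fin n => P)) (C := r * κ)
    (fun a b => ?_) (fun n => ?_) hε hN1 hj.le
  · have hma : Measurable fun u : Fin (a + b) → X => u ∘ Fin.castAdd b := by
      exact measurable_pi_lambda _ fun i => measurable_pi_apply _
    have hmb : Measurable fun u : Fin (a + b) → X => u ∘ Fin.natAdd a := by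
      exact measurable_pi_lambda _ fun i => measurable_pi_apply _
    have hea : Measurable (envelope (logDetGram k r (n := a)) θ₀ δ) :=
      measurable_envelope (hm a) hc θ₀ δ
    have heb : Measurable (envelope (logDetGram k r (n := b)) θ₀ δ) :=
      measurable_envelope (hm b) hc θ₀ δ
    rw [← map_pi_comp_injective P (Fin.castAdd_injective a b),
      ← map_pi_comp_injective P (Fin.natAdd_injective b a),
      lintegral_map hea hma, lintegral_map heb hmb]
    have hea' : Measurable fun u : Fin (a + b) → X =>
        envelope (logDetGram k r) θ₀ δ (u ∘ Fin.castAdd b) := hea.comp hma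
    rw [← lintegral_add_left hea']
    refine lintegral_mono fun u => envelope_le fun θ hθ => ?_
    have hadd : logDetGram k r θ u
        ≤ logDetGram k r θ (u ∘ Fin.castAdd b) + logDetGram k r θ (u ∘ Fin.natAdd a) :=
      log_det_gram_add_le (hk_psd θ) hr u
    refine (ENNReal.ofReal_le_ofReal hadd).trans ?_
    rw [ENNReal.ofReal_add (h0 θ _) (h0 θ _)]
    exact add_le_add (le_envelope (F := logDetGram k r) hθ (u ∘ Fin.castAdd b))
      (le_envelope (F := logDetGram k r) hθ (u ∘ Fin.natAdd a))
  · refine (lintegral_mono fun u => envelope_le fun θ _ =>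
      ENNReal.ofReal_le_ofReal (hB θ u)).trans ?_
    simp

end regret

/-! ### Divergence bounds for all parameters and for parameters near the truth -/

section bound

variable {ν σ : ℝ} {X Θ : Type*} {k : Θ → X → X → ℝ}

/-- The empty kernel combination approximates τ by 0; each covariate then contributes a bounded
amount to the squared error and to the trace that bounds the log-determinant. It serves when the
estimator is far from the truth. -/
theorem exists_klDensity_le_mul (hν : 1 < ν) (hσ : 0 < σ)
    (hk_psd : ∀ θ, (Matrix.of (k θ)).PosSemidef) {κ : ℝ} (hκ : ∀ θ x x', |k θ x x'| ≤ κ)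
    {τ : X → ℝ} {T : ℝ} (hτ : ∀ x, |τ x| ≤ T) :
    ∃ C : ℝ, ∀ (n : ℕ) (m : Fin n → ℝ) (u : Fin n → X) (θ : Θ),
      klDensity (condDensity ν σ m τ u) (predDensity ν σ (k θ) m u) ≤ ENNReal.ofReal (n * C) := by
  have hν1 : 0 < ν - 1 := by linarith
  refine ⟨ν / (2 * (ν - 1) * σ ^ 2) * T ^ 2
    + (ν / (2 * (ν - 1)) + 1 / 2) * ((σ ^ 2)⁻¹ * κ), fun n m u θ => ?_⟩
  refine (klDensity_condDensity_predDensity_le hν hσ (hk_psd θ) m τ u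
    (fun j : Fin 0 => j.elim0) (fun j : Fin 0 => j.elim0)).trans (ENNReal.ofReal_le_ofReal ?_)
  simp only [Finset.univ_eq_empty, Finset.sum_empty, sub_zero, zero_div, add_zero]
  have h1 : ∑ l, τ (u l) ^ 2 ≤ n * T ^ 2 := by
    refine (Finset.sum_le_card_nsmul _ _ (T ^ 2) fun l _ => ?_).trans (by simp)
    exact sq_le_sq' (abs_le.1 (hτ _)).1 (abs_le.1 (hτ _)).2
  have h2 := log_det_gram_le (hk_psd θ) (show 0 ≤ (σ ^ 2)⁻¹ by positivity)
    (fun x => (le_abs_self _).trans (hκ θ x x)) u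
  have h3 := mul_le_mul_of_nonneg_left h1 (show 0 ≤ ν / (2 * (ν - 1) * σ ^ 2) by positivity)
  have h4 := mul_le_mul_of_nonneg_left h2 (show 0 ≤ ν / (2 * (ν - 1)) + 1 / 2 by positivity)
  linarith

/-- The divergences for all parameters near `θ₀` are bounded by one function of the covariates,
whose expectation is a small multiple of the sample size. -/
theorem exists_klDensity_le_near [PseudoMetricSpace Θ] [TopologicalSpace.SeparableSpace Θ]
    [MeasurableSpace X] (hν : 1 < ν) (hσ : 0 < σ)
    (hk_psd : ∀ θ, (Matrix.of (k θ)).PosSemidef)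
    (hk_meas : ∀ θ, Measurable fun z : X × X => k θ z.1 z.2) {κ : ℝ}
    (hκ : ∀ θ x x', |k θ x x'| ≤ κ) (hk_cont : ∀ x x', Continuous fun θ => k θ x x')
    (P : Measure X) [IsProbabilityMeasure P] (θ₀ : Θ) {τ : X → ℝ} {M : ℝ}
    (hτ : RKHSNormLE (k θ₀) τ M)
    (hA : (fun n : ℕ => ∫ u, logDetGram k (σ ^ 2)⁻¹ θ₀ u ∂(Measure.pi fun _ : Fin n => P))
      =o[atTop] fun n : ℕ => (n : ℝ)) {ε : ℝ} (hε : 0 < ε) :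
    ∃ δ > 0, ∀ᶠ n : ℕ in atTop, ∃ H : (Fin n → X) → ℝ≥0∞, Measurable H ∧
      ∫⁻ u, H u ∂(Measure.pi fun _ : Fin n => P) ≤ ENNReal.ofReal (n * ε) ∧
      ∀ (m : Fin n → ℝ) (u : Fin n → X) (θ : Θ), dist θ θ₀ < δ →
        klDensity (condDensity ν σ m τ u) (predDensity ν σ (k θ) m u) ≤ H u := by
  have hν1 : 0 < ν - 1 := by linarith
  set r := (σ ^ 2)⁻¹ with hr
  have hr0 : 0 ≤ r := by positivity
  set C₁ := ν / (2 * (ν - 1) * σ ^ 2) with hC₁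
  set C₂ := ν / (2 * (ν - 1)) + 1 / 2 with hC₂
  have hC₁0 : 0 < C₁ := by positivity
  have hC₂0 : 0 < C₂ := by positivity
  obtain ⟨T, hT⟩ := hτ.exists_abs_le (hκ θ₀)
  -- The budget nε is shared equally by the squared error, the log-determinant and the norm term. At
  -- `θ₀` the squared error uses only ε/6 per covariate, which leaves room to pass to a ball.
  obtain ⟨N, x, a, hxa⟩ := hτ.exists_sum_kernel (hκ θ₀)
    (show 0 < √(ε / (6 * C₁)) by positivity)
  obtain ⟨δ₂, hδ₂, hev⟩ := exists_lintegral_envelope_logDetGram_le hk_psd hk_meas hκ hk_cont hr0 P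
    θ₀ hA (show 0 < ε / (3 * C₂) by positivity)
  -- The coefficients and centres found for `θ₀` are kept and only the kernel varies, so τ need not
  -- lie in the space of the kernel of θ.
  let F : Θ → X → ℝ := fun θ z => (τ z - ∑ j, a j * k θ z (x j)) ^ 2
  have hFm : ∀ θ, Measurable (F θ) := fun θ => by
    refine ((hτ.measurable (hκ θ₀) (hk_meas θ₀)).sub (Finset.measurable_sum _ fun j _ =>
      Measurable.const_mul ?_ _)).pow_const 2
    exact (hk_meas θ).comp measurable_prodMk_right
  have hFc : ∀ z, Continuous fun θ => F θ z := fun z =>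
    (continuous_const.sub (continuous_finsetSum _ fun j _ =>
      (hk_cont z (x j)).const_mul (a j))).pow 2
  have hFB : ∀ θ z, F θ z ≤ (T + ∑ j, |a j| * κ) ^ 2 := by
    intro θ z
    refine (sq_abs (τ z - ∑ j, a j * k θ z (x j))).symm.trans_le ?_
    refine pow_le_pow_left₀ (abs_nonneg _) ?_ 2
    refine (abs_sub _ _).trans (add_le_add (hT z) ?_)
    refine (Finset.abs_sum_le_sum_abs _ _).trans (Finset.sum_le_sum fun j _ => ?_)
    rw [abs_mul]
    exact mul_le_mul_of_nonneg_left (hκ θ _ _) (abs_nonneg _)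
  have hlt : ∫⁻ z, ENNReal.ofReal (F θ₀ z) ∂P < ENNReal.ofReal (ε / (3 * C₁)) := by
    calc ∫⁻ z, ENNReal.ofReal (F θ₀ z) ∂P ≤ ∫⁻ _, ENNReal.ofReal (ε / (6 * C₁)) ∂P := by
          refine lintegral_mono fun z => ENNReal.ofReal_le_ofReal ?_
          simp only [F]
          rw [← sq_abs, ← Real.sq_sqrt (show 0 ≤ ε / (6 * C₁) by positivity)]
          exact pow_le_pow_left₀ (abs_nonneg _) (hxa z) 2
      _ = ENNReal.ofReal (ε / (6 * C₁)) := by simp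
      _ < _ := by
        rw [ENNReal.ofReal_lt_ofReal_iff (by positivity)]
        exact div_lt_div_of_pos_left hε (by positivity) (by linarith)
  obtain ⟨j₀, hj₀⟩ := ((tendsto_lintegral_envelope hFm hFc hFB θ₀ P).eventually_lt_const
    hlt).exists
  set δ₁ := 1 / ((j₀ : ℝ) + 1)
  have hδ₁ : 0 < δ₁ := Nat.one_div_pos_of_nat
  -- A bound on the squared norm of the approximant that involves neither θ nor n, so it is
  -- negligible against n.
  set A := ∑ i, ∑ j, |a i| * |a j| * κ with hAdef
  have hAle : ∀ θ, ∑ i, ∑ j, a i * a j * k θ (x i) (x j) ≤ A := fun θ =>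
    Finset.sum_le_sum fun i _ => Finset.sum_le_sum fun j _ => by
      refine (le_abs_self _).trans ?_
      rw [abs_mul, abs_mul]
      exact mul_le_mul_of_nonneg_left (hκ _ _ _) (by positivity)
  have hA0 : 0 ≤ A := (kernelSum_self_nonneg (hk_psd θ₀) x a).trans (hAle θ₀)
  refine ⟨min δ₁ δ₂, lt_min hδ₁ hδ₂, ?_⟩
  have hlarge : ∀ᶠ n : ℕ in atTop, (A / 2) / (ε / 3) ≤ (n : ℝ) :=
    tendsto_natCast_atTop_atTop.eventually_ge_atTop _
  filter_upwards [hev, hlarge] with n hn hnA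
  have hΦ : Measurable (envelope F θ₀ δ₁) := measurable_envelope hFm hFc θ₀ δ₁
  have hΨ : Measurable (envelope (logDetGram k r (n := n)) θ₀ δ₂) :=
    measurable_envelope (measurable_logDetGram hk_meas r n)
      (fun u => continuous_logDetGram hk_psd hk_cont hr0 u) θ₀ δ₂
  have hΦs : Measurable fun u : Fin n → X => ∑ l, envelope F θ₀ δ₁ (u l) :=
    Finset.measurable_sum _ fun l _ => hΦ.comp (measurable_pi_apply l)
  refine ⟨fun u => ENNReal.ofReal C₁ * ∑ l, envelope F θ₀ δ₁ (u l)
    + ENNReal.ofReal C₂ * envelope (logDetGram k r) θ₀ δ₂ u + ENNReal.ofReal (A / 2), ?_, ?_, ?_⟩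
  · exact ((hΦs.const_mul _).add (hΨ.const_mul _)).add_const _
  · have hsum : ∫⁻ u : Fin n → X, ∑ l, envelope F θ₀ δ₁ (u l) ∂(Measure.pi fun _ => P)
        = ∑ l, ∫⁻ u : Fin n → X, envelope F θ₀ δ₁ (u l) ∂(Measure.pi fun _ => P) :=
      lintegral_finsetSum _ fun l _ => hΦ.comp (measurable_pi_apply l)
    rw [lintegral_add_right _ measurable_const, lintegral_add_right _ (hΨ.const_mul _),
      lintegral_const_mul _ hΦs, lintegral_const_mul _ hΨ, hsum]
    have h1 : ∀ l : Fin n, ∫⁻ u : Fin n → X, envelope F θ₀ δ₁ (u l) ∂(Measure.pi fun _ => P)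
        ≤ ENNReal.ofReal (ε / (3 * C₁)) := fun l =>
      ((measurePreserving_eval (fun _ : Fin n => P) l).lintegral_comp hΦ).trans_le hj₀.le
    have h2 : ∑ l : Fin n, ∫⁻ u : Fin n → X, envelope F θ₀ δ₁ (u l) ∂(Measure.pi fun _ => P)
        ≤ ENNReal.ofReal (n * (ε / (3 * C₁))) := by
      refine (Finset.sum_le_card_nsmul _ _ _ fun l _ => h1 l).trans (le_of_eq ?_)
      rw [ENNReal.ofReal_mul (by positivity)]
      simp
    calc _ ≤ ENNReal.ofReal C₁ * ENNReal.ofReal (n * (ε / (3 * C₁)))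
          + ENNReal.ofReal C₂ * ENNReal.ofReal (n * (ε / (3 * C₂))) + ENNReal.ofReal (A / 2) := by
          gcongr
          simp
      _ = ENNReal.ofReal (C₁ * (n * (ε / (3 * C₁))) + C₂ * (n * (ε / (3 * C₂))) + A / 2) := by
          rw [← ENNReal.ofReal_mul hC₁0.le, ← ENNReal.ofReal_mul hC₂0.le,
            ENNReal.ofReal_add (by positivity) (by positivity),
            ENNReal.ofReal_add (by positivity) (by positivity)]
      _ ≤ _ := by
          apply ENNReal.ofReal_le_ofReal
          rw [div_le_iff₀ (by positivity)] at hnA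
          have e1 : C₁ * (n * (ε / (3 * C₁))) = n * (ε / 3) := by field_simp
          have e2 : C₂ * (n * (ε / (3 * C₂))) = n * (ε / 3) := by field_simp
          rw [e1, e2]
          linarith
  · intro m u θ hθ
    refine (klDensity_condDensity_predDensity_le hν hσ (hk_psd θ) m τ u x a).trans ?_
    have hL : 0 ≤ logDetGram k r θ u := log_det_gram_nonneg (hk_psd θ) hr0 u
    have hS : 0 ≤ ∑ l, F θ (u l) := Finset.sum_nonneg fun l _ => sq_nonneg _
    calc _ ≤ ENNReal.ofReal (C₁ * ∑ l, F θ (u l) + C₂ * logDetGram k r θ u + A / 2) := by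
          apply ENNReal.ofReal_le_ofReal
          have := hAle θ
          rw [← hr, ← hC₁, ← hC₂]
          simp only [F, logDetGram]
          linarith
      _ = ENNReal.ofReal C₁ * ∑ l, ENNReal.ofReal (F θ (u l))
          + ENNReal.ofReal C₂ * ENNReal.ofReal (logDetGram k r θ u) + ENNReal.ofReal (A / 2) := by
          rw [ENNReal.ofReal_add (add_nonneg (mul_nonneg hC₁0.le hS) (mul_nonneg hC₂0.le hL))
            (by positivity), ENNReal.ofReal_add (mul_nonneg hC₁0.le hS) (mul_nonneg hC₂0.le hL),
            ENNReal.ofReal_mul hC₁0.le, ENNReal.ofReal_mul hC₂0.le,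
            ENNReal.ofReal_sum_of_nonneg fun l _ => sq_nonneg _]
      _ ≤ _ := by
          beta_reduce
          gcongr with l
          · exact le_envelope (hθ.trans_le (min_le_left _ _)) _
          · exact le_envelope (F := logDetGram k r) (hθ.trans_le (min_le_right _ _)) u

end bound

end FAnova

/-! ### Combination: estimator near or far from the truth -/

theorem theorem2
    -- the curves, the parameters of the error process, the mean functions, the observation times
    {I : ℕ} (J : Fin I → ℕ) (ν σ : ℝ) (hν : 1 < ν) (hσ : 0 < σ)
    (μ : ℝ → ℝ) (α : Fin I → ℝ → ℝ) (hα : ∀ s, ∑ i, α i s = 0)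
    (t : (n : ℕ) → Fin n → ℝ)
    -- the covariate space and the laws of the covariates
    {p : ℕ} (X : Set (EuclideanSpace ℝ (Fin p)))
    (P : FAnova.Curve J → Measure X) [∀ c, IsProbabilityMeasure (P c)]
    -- the kernels: positive semidefinite, measurable, bounded, and continuous in the parameter
    {q : ℕ} (Θ : Set (EuclideanSpace ℝ (Fin q))) (k : Θ → X → X → ℝ)
    (hk_psd : ∀ θ, (Matrix.of (k θ)).PosSemidef)
    (hk_meas : ∀ θ, Measurable fun z : X × X => k θ z.1 z.2)
    (hk_bdd : ∃ κ : ℝ, ∀ θ x x', |k θ x x'| ≤ κ)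
    (hk_cont : ∀ x x', Continuous fun θ => k θ x x')
    -- the true parameters and the true random effects
    (θ₀ : FAnova.Curve J → Θ) (τ₀ : FAnova.Curve J → X → ℝ)
    -- consistent estimators of the parameters from the whole data set
    (θhat : FAnova.Curve J → (n : ℕ) → FAnova.DataSet X J n → Θ)
    (hθ_meas : ∀ c n, Measurable (θhat c n))
    (hθ_cons : ∀ c, ∀ ε : ℝ, 0 < ε →
      Tendsto (fun n => FAnova.dataLaw ν σ μ α P τ₀ (t n) {d | ε ≤ dist (θhat c n d) (θ₀ c)})
        atTop (𝓝 0))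
    -- condition (A)
    (hA_norm : ∀ c, ∃ M : ℝ, FAnova.RKHSNormLE (k (θ₀ c)) (τ₀ c) M)
    (hA_regret : ∀ c,
      (fun n : ℕ => ∫ u, Real.log (1 + (σ ^ 2)⁻¹ • FAnova.gram (k (θ₀ c)) u).det
        ∂(Measure.pi fun _ : Fin n => P c)) =o[atTop] fun n : ℕ => (n : ℝ)) :
    ∀ c : FAnova.Curve J,
      -- the covariates are those of the data set
      Tendsto (fun n : ℕ =>
        (∫⁻ d, FAnova.klDensity
            (FAnova.condDensity ν σ (FAnova.meanVec μ α c (t n)) (τ₀ c) (d c).1)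
            (FAnova.predDensity ν σ (k (θhat c n d)) (FAnova.meanVec μ α c (t n)) (d c).1)
          ∂(FAnova.dataLaw ν σ μ α P τ₀ (t n))) / (n : ℝ≥0∞)) atTop (𝓝 0) ∧
      -- the expectation over the covariates is taken with the value of the estimator held fixed
      Tendsto (fun n : ℕ =>
        (∫⁻ d, ∫⁻ u, FAnova.klDensity
            (FAnova.condDensity ν σ (FAnova.meanVec μ α c (t n)) (τ₀ c) u)
            (FAnova.predDensity ν σ (k (θhat c n d)) (FAnova.meanVec μ α c (t n)) u)
            ∂(Measure.pi fun _ : Fin n => P c)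
          ∂(FAnova.dataLaw ν σ μ α P τ₀ (t n))) / (n : ℝ≥0∞)) atTop (𝓝 0) := by
  intro c
  obtain ⟨κ, hκ⟩ := hk_bdd
  have hτ : ∀ c, Measurable (τ₀ c) := fun c => by
    obtain ⟨M, hM⟩ := hA_norm c
    exact hM.measurable (hκ _) (hk_meas _)
  obtain ⟨M, hM⟩ := hA_norm c
  obtain ⟨T, hT⟩ := hM.exists_abs_le (hκ _)
  obtain ⟨C, hC⟩ := FAnova.exists_klDensity_le_mul hν hσ hk_psd hκ hT
  have hprob := fun n => FAnova.isProbabilityMeasure_dataLaw hν hσ μ α P hτ (t n)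
  -- The covariates `u` and the data `d` are unrelated here: `H` does not involve the estimator, and
  -- the indicator does not involve `u`. Hence the dependence between estimator and covariates is
  -- harmless, and both limits use the same bound.
  have key : ∀ ε : ℝ≥0∞, 0 < ε → ∀ᶠ n : ℕ in atTop, ∃ H : (Fin n → X) → ℝ≥0∞, ∃ δ : ℝ,
      Measurable H ∧
      (∀ (u : Fin n → X) (d : FAnova.DataSet X J n),
        FAnova.klDensity (FAnova.condDensity ν σ (FAnova.meanVec μ α c (t n)) (τ₀ c) u)
          (FAnova.predDensity ν σ (k (θhat c n d)) (FAnova.meanVec μ α c (t n)) u)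
        ≤ H u + {d | δ ≤ dist (θhat c n d) (θ₀ c)}.indicator
            (fun _ => ENNReal.ofReal (n * C)) d) ∧
      (∫⁻ u, H u ∂(Measure.pi fun _ : Fin n => P c)
        + ENNReal.ofReal (n * C) * FAnova.dataLaw ν σ μ α P τ₀ (t n)
            {d | δ ≤ dist (θhat c n d) (θ₀ c)}) / n ≤ ε := by
    intro ε hε
    obtain ⟨e, he0, heε⟩ : ∃ e : ℝ, 0 < e ∧ ENNReal.ofReal e + ENNReal.ofReal e ≤ ε := by
      -- An intermediate value is needed because ε may be infinite.
      obtain ⟨b, hb0, hb⟩ := exists_between hε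
      have hbt : b ≠ ∞ := hb.ne_top
      refine ⟨b.toReal / 2, by have := ENNReal.toReal_pos hb0.ne' hbt; positivity, ?_⟩
      rw [← ENNReal.ofReal_add (by positivity) (by positivity), add_halves, ENNReal.ofReal_toReal hbt]
      exact hb.le
    obtain ⟨δ, hδ, hev⟩ := FAnova.exists_klDensity_le_near hν hσ hk_psd hk_meas hκ hk_cont (P c)
      (θ₀ c) hM (hA_regret c) he0
    have hfar : ∀ᶠ n : ℕ in atTop, ENNReal.ofReal C * FAnova.dataLaw ν σ μ α P τ₀ (t n)
        {d | δ ≤ dist (θhat c n d) (θ₀ c)} < ENNReal.ofReal e := by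
      have := ENNReal.Tendsto.const_mul (a := ENNReal.ofReal C) (hθ_cons c δ hδ)
        (Or.inr ENNReal.ofReal_ne_top)
      rw [mul_zero] at this
      exact this.eventually_lt_const (ENNReal.ofReal_pos.2 he0)
    filter_upwards [hev, hfar, eventually_gt_atTop 0] with n ⟨H, hHm, hHi, hH⟩ hn hn0
    refine ⟨H, δ, hHm, fun u d => ?_, ?_⟩
    · by_cases hd : δ ≤ dist (θhat c n d) (θ₀ c)
      · rw [Set.indicator_of_mem (show d ∈ {d | δ ≤ dist (θhat c n d) (θ₀ c)} from hd)]
        exact (hC n _ u _).trans le_add_self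
      · exact (hH _ u _ (not_le.1 hd)).trans le_self_add
    · have hn' : (n : ℝ≥0∞) ≠ 0 := by exact_mod_cast hn0.ne'
      rw [ENNReal.div_le_iff hn' (ENNReal.natCast_ne_top n)]
      calc _ ≤ (n : ℝ≥0∞) * ENNReal.ofReal e + n * ENNReal.ofReal e := by
            rw [ENNReal.ofReal_mul (by positivity), ENNReal.ofReal_natCast] at hHi ⊢
            rw [mul_assoc]
            gcongr
        _ = (ENNReal.ofReal e + ENNReal.ofReal e) * n := by ring
        _ ≤ ε * n := by gcongr
  have hS : ∀ (n : ℕ) (δ : ℝ), MeasurableSet {d | δ ≤ dist (θhat c n d) (θ₀ c)} := fun n δ =>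
    measurableSet_le measurable_const ((hθ_meas c n).dist measurable_const)
  constructor
  · refine ENNReal.tendsto_nhds_zero.2 fun ε hε => ?_
    filter_upwards [key ε hε] with n ⟨H, δ, hHm, hH, hle⟩
    refine le_trans (ENNReal.div_le_div_right ?_ _) hle
    -- Monotonicity of the lower integral needs no measurability of the divergence in the data; only
    -- the majorant has to be measurable.
    calc _ ≤ ∫⁻ d, (H (d c).1 + {d | δ ≤ dist (θhat c n d) (θ₀ c)}.indicator
          (fun _ => ENNReal.ofReal (n * C)) d) ∂(FAnova.dataLaw ν σ μ α P τ₀ (t n)) :=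
          lintegral_mono fun d => hH (d c).1 d
      _ = _ := ?_
    rw [lintegral_add_right _ (measurable_const.indicator (hS n δ)),
      FAnova.lintegral_dataLaw_covariates hν hσ μ α P hτ (t n) c hHm,
      lintegral_indicator_const (hS n δ)]
  · refine ENNReal.tendsto_nhds_zero.2 fun ε hε => ?_
    filter_upwards [key ε hε] with n ⟨H, δ, hHm, hH, hle⟩
    refine le_trans (ENNReal.div_le_div_right ?_ _) hle
    calc _ ≤ ∫⁻ d, ∫⁻ u, (H u + {d | δ ≤ dist (θhat c n d) (θ₀ c)}.indicator
          (fun _ => ENNReal.ofReal (n * C)) d) ∂(Measure.pi fun _ : Fin n => P c)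
          ∂(FAnova.dataLaw ν σ μ α P τ₀ (t n)) :=
          lintegral_mono fun d => lintegral_mono fun u => hH u d
      _ = _ := ?_
    simp_rw [lintegral_add_right _ measurable_const]
    rw [lintegral_add_left measurable_const]
    simp only [lintegral_const, measure_univ, mul_one]
    rw [lintegral_indicator_const (hS n δ)]
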